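/- **Conventions.** $\mathbb{E}^{n+1}_s$ is $\mathbb{R}^{n+1}$ with $\langle x,y\rangle=\sum_{i=1}^{n+1-s}x_iy_i-\sum_{i=n+2-s}^{n+1}x_iy_i$, $0\le s\le n+1$. Let $\Pi\subset\mathbb{E}^{n+1}_s$ be a 2-plane on which the metric is nondegenerate, $d\subset\Pi$ a straight line (the axis; it may be spacelike, timelike or null), and $\alpha:J\to\Pi$ a smooth regular curve on an open interval $J$ which does not meet $d$. The *rotational hypersurface* with axis $d$ and profile curve $\alpha$ is the image of $\alpha$ under the group of isometries of $\mathbb{E}^{n+1}_s$ which fix $d$ pointwise. **Theorem.** Let $n\ge 3$, let $\bar M^{n-1}(c)$ be a connected pseudo-Riemannian manifold (with a metric $g$ of any signature) of dimension $n-1$ and constant sectional curvature $c$, let $I\subset\mathbb{R}$ be an open interval, $f:I\to(0,\infty)$ a smooth non-constant function, and let $M^n=I\times_f\bar M^{n-1}(c)$ be the warped product, with metric $\pm dt^2+f(t)^2g$. If $n=3$, assume moreover that $f''$ does not vanish identically on any nonempty open subinterval of $I$. Let $F:M^n\to\mathbb{E}^{n+1}_s$ be a smooth non-degenerate isometric immersion,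 where $s$ is arbitrary. Let $U$ be the set of all $t\in I$ such that, at the points $(t,q)$, the sectional curvature of $M^n$ is not the same for all nondegenerate tangent planes. Whether this holds depends only on $t$ and not on $q$, and $U$ is open. Moreover: 1. for every nonempty open interval $J\subset I\setminus U$, the manifold $J\times_f\bar M^{n-1}(c)$ has constant sectional curvature; 2. for every nonempty open interval $J\subset U$, $F$ maps $J\times_f\bar M^{n-1}(c)$ into a rotational hypersurface. More precisely, there are an axis $d$, a plane $\Pi\supset d$ and a profile curve $\alpha:J\to\Pi$ as above and, for every $q\in\bar M^{n-1}(c)$, an isometry $A_q$ of $\mathbb{E}^{n+1}_s$ fixing $d$ pointwise, such that $F(t,q)=A_q(\alpha(t))$ for all $t\in J$. In particular, $M^n$ has constant sectional curvature if $U=\emptyset$, and is a rotational hypersurface if $U=I$. -/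

import Mathlib

open Set
open scoped Manifold ContDiff Topology

noncomputable section

/-! ### Pseudo-Riemannian metrics and their sectional curvature -/

/-- The pullback `(u, v) ↦ B (L u) (L v)` of a bilinear form `B` along a linear map `L`. -/
def pullbackForm {V W : Type*}
    [AddCommGroup V] [Module ℝ V] [TopologicalSpace V] [IsTopologicalAddGroup V]
    [ContinuousSMul ℝ V]
    [AddCommGroup W] [Module ℝ W] [TopologicalSpace W] [IsTopologicalAddGroup W]
    [ContinuousSMul ℝ W]
    (B : W →L[ℝ] W →L[ℝ] ℝ) (L : V →L[ℝ] W) : V →L[ℝ] V →L[ℝ] ℝ :=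
  (ContinuousLinearMap.precomp ℝ L).comp (B.comp L)

section Curvature

variable {E : Type*} [NormedAddCommGroup E] [NormedSpace ℝ E]

/-- The Christoffel symbol `Γ_y(u, v)` (a vector of `E`) of a field `G` of symmetric
nondegenerate bilinear forms on the vector space `E`:
`2 G_y(Γ_y(u, v), w) = (D_u G)(v, w) + (D_v G)(u, w) - (D_w G)(u, v)`. -/
def christoffel (G : E → E →L[ℝ] E →L[ℝ] ℝ) (y u v : E) : E :=
  (G y).inverse
    ((1 / 2 : ℝ) • (fderiv ℝ G y u v + fderiv ℝ G y v u
      - ((fderiv ℝ G y).flip u).flip v))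

/-- The Riemann curvature tensor `R_y(u, v) w` of the Levi-Civita connection of `G`, for
constant vector fields `u, v, w`, with `R(u, v) w = ∇_u ∇_v w - ∇_v ∇_u w`. -/
def riemannCurvature (G : E → E →L[ℝ] E →L[ℝ] ℝ) (y u v w : E) : E :=
  fderiv ℝ (fun z => christoffel G z v w) y u - fderiv ℝ (fun z => christoffel G z u w) y v
    + christoffel G y u (christoffel G y v w) - christoffel G y v (christoffel G y u w)

variable {H : Type*} [TopologicalSpace H] (I : ModelWithCorners ℝ E H)
  {M : Type*} [TopologicalSpace M] [ChartedSpace H M]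

/-- The coordinate expression, in the preferred chart at `x`, of a field `g` of bilinear forms
on the tangent spaces of `M`. -/
def chartMetric (g : ∀ x : M, TangentSpace I x →L[ℝ] TangentSpace I x →L[ℝ] ℝ) (x : M) (y : E) :
    E →L[ℝ] E →L[ℝ] ℝ :=
  pullbackForm (g ((extChartAt I x).symm y)) (mfderiv 𝓘(ℝ, E) I (extChartAt I x).symm y)

/-- `g` is a (smooth) pseudo-Riemannian metric on `M`, of any signature. -/
structure IsPseudoRiemannianMetric
    (g : ∀ x : M, TangentSpace I x →L[ℝ] TangentSpace I x →L[ℝ] ℝ) : Prop where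
  symm : ∀ (x : M) (u v : TangentSpace I x), g x u v = g x v u
  nondegenerate : ∀ (x : M) (u : TangentSpace I x), (∀ v : TangentSpace I x, g x u v = 0) → u = 0
  smooth : ∀ x : M, ContDiffOn ℝ ∞ (chartMetric I g x) (extChartAt I x).target

/-- The sectional curvature at `x` of the tangent plane spanned by `u` and `v`, computed in the
preferred chart at `x`, for which the tangent space at `x` is `E` itself. It is meaningful when
the plane is nondegenerate, that is, when the denominator is not zero. -/
def sectionalCurvature (g : ∀ x : M, TangentSpace I x →L[ℝ] TangentSpace I x →L[ℝ] ℝ) (x : M)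
    (u v : TangentSpace I x) : ℝ :=
  g x (riemannCurvature (E := E) (chartMetric I g x) (extChartAt I x x) u v v) u
    / (g x u u * g x v v - g x u v ^ 2)

/-- All nondegenerate tangent planes at the point `x` have sectional curvature `K`. -/
def HasSectionalCurvatureAt (g : ∀ x : M, TangentSpace I x →L[ℝ] TangentSpace I x →L[ℝ] ℝ)
    (x : M) (K : ℝ) : Prop :=
  ∀ u v : TangentSpace I x, g x u u * g x v v - g x u v ^ 2 ≠ 0 →
    sectionalCurvature I g x u v = K

end Curvature

/-- The warped product metric `η dt² + f(t)² g` on `ℝ × N` (it is used over an interval). -/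
def warpedMetric {E : Type*} [NormedAddCommGroup E] [NormedSpace ℝ E]
    {H : Type*} [TopologicalSpace H] (I : ModelWithCorners ℝ E H)
    {N : Type*} [TopologicalSpace N] [ChartedSpace H N] (η : ℝ) (f : ℝ → ℝ)
    (g : ∀ x : N, TangentSpace I x →L[ℝ] TangentSpace I x →L[ℝ] ℝ) (p : ℝ × N) :
    TangentSpace (𝓘(ℝ, ℝ).prod I) p →L[ℝ] TangentSpace (𝓘(ℝ, ℝ).prod I) p →L[ℝ] ℝ :=
  η • pullbackForm (ContinuousLinearMap.mul ℝ ℝ) (ContinuousLinearMap.fst ℝ ℝ E)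
    + f p.1 ^ 2 • pullbackForm (g p.2) (ContinuousLinearMap.snd ℝ ℝ E)

/-! ### Pseudo-Euclidean space and rotational hypersurfaces -/

/-- The inner product of the pseudo-Euclidean space of dimension `m` and signature `s`:
`⟨x, y⟩ = x₁ y₁ + ⋯ + x_{m-s} y_{m-s} - x_{m-s+1} y_{m-s+1} - ⋯ - x_m y_m`. -/
def pseudoInner {m : ℕ} (s : ℕ) (x y : Fin m → ℝ) : ℝ :=
  ∑ i : Fin m, (if (i : ℕ) + s < m then 1 else -1) * (x i * y i)

/-- `F` is an isometric immersion, over the interval `J`, of `ℝ × N` with the metric `h` into the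
pseudo-Euclidean space. -/
structure IsIsometricImmersionOver {E : Type*} [NormedAddCommGroup E] [NormedSpace ℝ E]
    {H : Type*} [TopologicalSpace H] (I : ModelWithCorners ℝ E H)
    {N : Type*} [TopologicalSpace N] [ChartedSpace H N] {m : ℕ} (s : ℕ) (J : Set ℝ)
    (h : ∀ p : ℝ × N,
      TangentSpace (𝓘(ℝ, ℝ).prod I) p →L[ℝ] TangentSpace (𝓘(ℝ, ℝ).prod I) p →L[ℝ] ℝ)
    (F : ℝ × N → Fin m → ℝ) : Prop where
  smooth : ContMDiffOn (𝓘(ℝ, ℝ).prod I) 𝓘(ℝ, Fin m → ℝ) ∞ F (J ×ˢ univ)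
  injective : ∀ p ∈ J ×ˢ (univ : Set N),
    Function.Injective (mfderiv (𝓘(ℝ, ℝ).prod I) 𝓘(ℝ, Fin m → ℝ) F p)
  isometric : ∀ p ∈ J ×ˢ (univ : Set N), ∀ u v : TangentSpace (𝓘(ℝ, ℝ).prod I) p,
    pseudoInner (m := m) s (mfderiv (𝓘(ℝ, ℝ).prod I) 𝓘(ℝ, Fin m → ℝ) F p u)
      (mfderiv (𝓘(ℝ, ℝ).prod I) 𝓘(ℝ, Fin m → ℝ) F p v) = h p u v

/-- `α : J → P` is a smooth regular curve in a nondegenerate 2-plane `P`, which contains the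
axis `ℝ a` (spacelike, timelike or null), and `α` does not meet the axis. -/
structure IsProfileCurve {m : ℕ} (s : ℕ) (J : Set ℝ) (P : Submodule ℝ (Fin m → ℝ))
    (a : Fin m → ℝ) (α : ℝ → Fin m → ℝ) : Prop where
  finrank_plane : Module.finrank ℝ P = 2
  nondegenerate_plane : ∀ x ∈ P, (∀ y ∈ P, pseudoInner s x y = 0) → x = 0
  axis_mem : a ∈ P
  axis_ne_zero : a ≠ 0
  smooth : ContDiffOn ℝ ∞ α J
  mem_plane : ∀ t ∈ J, α t ∈ P
  regular : ∀ t ∈ J, deriv α t ≠ 0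
  off_axis : ∀ t ∈ J, α t ∉ Submodule.span ℝ {a}

/-- The linear isometries of the pseudo-Euclidean space which fix the line `ℝ a` pointwise. -/
def rotationsAbout {m : ℕ} (s : ℕ) (a : Fin m → ℝ) : Set ((Fin m → ℝ) ≃ₗ[ℝ] (Fin m → ℝ)) :=
  {A | (∀ x y, pseudoInner s (A x) (A y) = pseudoInner s x y) ∧ A a = a}

/-- The rotational hypersurface with axis `o + ℝ a` generated by the curve `o + α`: the image of
the curve under the isometries which keep the axis fixed. -/
def rotationalHypersurface {m : ℕ} (s : ℕ) (J : Set ℝ) (o a : Fin m → ℝ) (α : ℝ → Fin m → ℝ) :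
    Set (Fin m → ℝ) :=
  {x | ∃ t ∈ J, ∃ A ∈ rotationsAbout s a, x = o + A (α t)}

/-- Over the interval `J`, the map `F` parametrizes (an open piece of) a rotational hypersurface,
and does so in the standard way: every curve `t ↦ F (t, q)` is the rotated profile curve. -/
def IsRotationalOver {m : ℕ} {N : Type*} (s : ℕ) (J : Set ℝ) (F : ℝ × N → Fin m → ℝ) : Prop :=
  ∃ (P : Submodule ℝ (Fin m → ℝ)) (o a : Fin m → ℝ) (α : ℝ → Fin m → ℝ),
    IsProfileCurve s J P a α ∧
    F '' (J ×ˢ univ) ⊆ rotationalHypersurface s J o a α ∧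
    ∀ q : N, ∃ A ∈ rotationsAbout s a, ∀ t ∈ J, F (t, q) = o + A (α t)

end

/-! Curvature of the warped product. Only two numbers occur: `-η f''/f` on planes containing `∂_t`,
and `(c - η f'²)/f²` on planes tangent to the fibre (`sectionalCurvature_warpedMetric`). Curvature
at `(t, q)` is thus independent of the plane iff `δ = c - η f'² + η f f''` vanishes at `t`, and `U`
is where `δ ≠ 0`. The derivative of `(c - η f'²)/f²` is `-2 f' δ / f³`, so on an interval where `δ =
0` the curvature does not depend on `t` either.

Second fundamental form. Put `K = c - η f'²`. Over `U`, `f''` and `K` do not both vanish. The Gauss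
equation (`gauss_equation`) then forces `∂_t` to be a principal direction (`mixed_part_eq_zero`). It
also makes the second fundamental form a multiple of the metric along the fibre, with `K ≠ 0`, as
soon as `f'' ≠ 0` (`umbilic_of_mixed_ne_zero`) or the fibre has dimension at least 3
(`umbilic_of_three_le`). For a two-dimensional fibre and `f'' = 0`, Gauss controls only a
determinant; hence the extra hypothesis when `n = 3`.

Reconstruction. Fix one `t₁` where umbilicity holds, let `T(q)` be the velocity of `t ↦ F(t, q)` at
`t₁`, and `Z(q)` the normal with `⟨Z, Z⟩ = f² K` that represents the fibre part of the second
fundamental form. Along the slice, `dT = (f'/f) dF` and `dZ = -K dF` (`umbilic_field_hasFDerivAt`).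
So `o = F + Z/K` and `b = K f T + f' Z` are constant: they are a point and a direction of the axis.
Because `∂_t` is principal throughout the interval, tangent spaces of the slices stay parallel along
each curve `t ↦ F(t, q)`; therefore `F(t, q) - o = x(t) T(q) + y(t) Z(q)` with `x, y` independent of
`q`. Witt's theorem gives an isometry taking `(T, Z)` at `q₀` to `(T, Z)` at `q`; it fixes `b` and
carries one curve to the other (`isRotationalOver`). -/

set_option maxSynthPendingDepth 3

/-! ### Christoffel symbols and curvature of a metric on a vector space -/

section CurvatureFormula

variable {E : Type*} [NormedAddCommGroup E] [NormedSpace ℝ E]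

theorem apply_christoffel {G : E → E →L[ℝ] E →L[ℝ] ℝ} {z : E} (h : (G z).IsInvertible)
    (u v w : E) :
    G z (christoffel G z u v) w
      = 1 / 2 * (fderiv ℝ G z u v w + fderiv ℝ G z v u w - fderiv ℝ G z w u v) := by
  simp [christoffel, h.self_apply_inverse]

theorem christoffel_eq {G : E → E →L[ℝ] E →L[ℝ] ℝ} {z : E} (h : (G z).IsInvertible)
    {u v a : E}
    (ha : ∀ w, G z a w = 1 / 2 * (fderiv ℝ G z u v w + fderiv ℝ G z v u w - fderiv ℝ G z w u v)) :
    christoffel G z u v = a := by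
  have : G z (christoffel G z u v) = G z a := by
    ext w
    rw [apply_christoffel h, ha]
  rw [← h.inverse_apply_self (christoffel G z u v), this, h.inverse_apply_self]

theorem christoffel_congr {G G' : E → E →L[ℝ] E →L[ℝ] ℝ} {z : E} (h : G =ᶠ[𝓝 z] G') (u v : E) :
    christoffel G z u v = christoffel G' z u v := by
  simp only [christoffel, h.fderiv_eq, h.eq_of_nhds]

theorem riemannCurvature_congr {G G' : E → E →L[ℝ] E →L[ℝ] ℝ} {z : E} (h : G =ᶠ[𝓝 z] G')
    (u v w : E) :
    riemannCurvature G z u v w = riemannCurvature G' z u v w := by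
  have h1 : ∀ v w, (fun x => christoffel G x v w) =ᶠ[𝓝 z] fun x => christoffel G' x v w := by
    intro v w
    filter_upwards [h.eventuallyEq_nhds] with x hx using christoffel_congr hx v w
  simp only [riemannCurvature, (h1 _ _).fderiv_eq, christoffel_congr h]

theorem fderiv_apply_symm {G : E → E →L[ℝ] E →L[ℝ] ℝ} {z : E} (hG : DifferentiableAt ℝ G z)
    (hs : ∀ᶠ x in 𝓝 z, ∀ a b, G x a b = G x b a) (u a b : E) :
    fderiv ℝ G z u a b = fderiv ℝ G z u b a := by
  have h1 : ∀ a b, HasFDerivAt (fun x => G x a b) _ z := fun a b =>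
    (hG.hasFDerivAt.clm_apply (hasFDerivAt_const a z)).clm_apply (hasFDerivAt_const b z)
  have h2 : (fun x => G x a b) =ᶠ[𝓝 z] fun x => G x b a := by
    filter_upwards [hs] with x hx using hx a b
  have := ((h1 a b).congr_of_eventuallyEq h2.symm).unique (h1 b a)
  simpa using congrArg (fun L => L u) this

variable [FiniteDimensional ℝ E]

theorem eventually_isInvertible {G : E → E →L[ℝ] E →L[ℝ] ℝ} {y : E} (hG : ContinuousAt G y)
    (h : (G y).IsInvertible) : ∀ᶠ z in 𝓝 y, (G z).IsInvertible := by
  have : CompleteSpace E := FiniteDimensional.complete ℝ E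
  obtain ⟨e, he⟩ := h
  have := hG.eventually (he ▸ ContinuousLinearEquiv.nhds e)
  filter_upwards [this] with z hz using hz

theorem contDiffAt_christoffel {G : E → E →L[ℝ] E →L[ℝ] ℝ} {y : E} (hG : ContDiffAt ℝ ∞ G y)
    (h : (G y).IsInvertible) (u v : E) :
    ContDiffAt ℝ ∞ (fun z => christoffel G z u v) y := by
  have : CompleteSpace E := FiniteDimensional.complete ℝ E
  have h1 : ContDiffAt ℝ ∞ (fun z => (G z).inverse) y :=
    (h.contDiffAt_map_inverse).comp y hG
  have h2 : ContDiffAt ℝ ∞ (fderiv ℝ G) y := hG.fderiv_right (by simp)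
  have h3 : ContDiffAt ℝ ∞ (fun z => ((fderiv ℝ G z).flip u).flip v) y := by
    -- The last Koszul term `w ↦ (D_w G)(u, v)` is the image of `DG` under a fixed continuous linear
    -- map, so it is as smooth as `DG`.
    let Φ : (E →L[ℝ] E →L[ℝ] E →L[ℝ] ℝ) →L[ℝ] E →L[ℝ] ℝ :=
      (ContinuousLinearMap.apply ℝ (E →L[ℝ] ℝ) v).comp
        (((ContinuousLinearMap.flipₗᵢ ℝ E E ℝ).toContinuousLinearEquiv :
          (E →L[ℝ] E →L[ℝ] ℝ) →L[ℝ] (E →L[ℝ] E →L[ℝ] ℝ)).comp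
        ((ContinuousLinearMap.apply ℝ (E →L[ℝ] E →L[ℝ] ℝ) u).comp
          ((ContinuousLinearMap.flipₗᵢ ℝ E E (E →L[ℝ] ℝ)).toContinuousLinearEquiv :
            (E →L[ℝ] E →L[ℝ] E →L[ℝ] ℝ) →L[ℝ] (E →L[ℝ] E →L[ℝ] E →L[ℝ] ℝ))))
    exact Φ.contDiff.contDiffAt.comp y h2
  unfold christoffel
  refine h1.clm_apply (ContDiffAt.const_smul _ (ContDiffAt.sub (ContDiffAt.add ?_ ?_) h3))
  · exact (h2.clm_apply contDiffAt_const).clm_apply contDiffAt_const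
  · exact (h2.clm_apply contDiffAt_const).clm_apply contDiffAt_const

/-- The curvature in terms of second derivatives of the metric and of Christoffel symbols. -/
theorem apply_riemannCurvature {G : E → E →L[ℝ] E →L[ℝ] ℝ} {y : E} (hG : ContDiffAt ℝ ∞ G y)
    (h : (G y).IsInvertible) (hs : ∀ᶠ x in 𝓝 y, ∀ a b, G x a b = G x b a) (u v : E) :
    G y (riemannCurvature G y u v v) u
      = fderiv ℝ (fderiv ℝ G) y u v u v - 1 / 2 * fderiv ℝ (fderiv ℝ G) y u u v v
        - 1 / 2 * fderiv ℝ (fderiv ℝ G) y v v u u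
        + G y (christoffel G y u v) (christoffel G y u v)
        - G y (christoffel G y u u) (christoffel G y v v) := by
  have hd : DifferentiableAt ℝ G y := hG.differentiableAt (by simp)
  have hd2 : DifferentiableAt ℝ (fderiv ℝ G) y :=
    (hG.fderiv_right (m := ∞) (by simp)).differentiableAt (by simp)
  have hdd : ∀ᶠ z in 𝓝 y, DifferentiableAt ℝ G z :=
    ((hG.of_le (m := 1) (by simp)).eventually (by simp)).mono
      fun z hz => hz.differentiableAt (by simp)
  have hS : ∀ᶠ z in 𝓝 y, ∀ u a b, fderiv ℝ G z u a b = fderiv ℝ G z u b a := by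
    filter_upwards [hdd, hs.eventually_nhds] with z h1 h2 u a b using fderiv_apply_symm h1 h2 u a b
  have hH : ∀ b c d : E, HasFDerivAt (fun z => fderiv ℝ G z b c d) _ y := fun b c d =>
    ((hd2.hasFDerivAt.clm_apply (hasFDerivAt_const b y)).clm_apply
      (hasFDerivAt_const c y)).clm_apply (hasFDerivAt_const d y)
  have hHs : ∀ a b c d : E, fderiv ℝ (fderiv ℝ G) y a b c d
      = fderiv ℝ (fderiv ℝ G) y a b d c := by
    intro a b c d
    have h2 : (fun x => fderiv ℝ G x b c d) =ᶠ[𝓝 y] fun x => fderiv ℝ G x b d c := by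
      filter_upwards [hS] with x hx using hx b c d
    have := ((hH b c d).congr_of_eventuallyEq h2.symm).unique (hH b d c)
    simpa using congrArg (fun L => L a) this
  -- Differentiating the Koszul identity for `G(Γ(p, q), w)` yields the derivative of `Γ` paired
  -- with `w`, without differentiating the inverse of `G`.
  have key : ∀ a p q w : E, G y (fderiv ℝ (fun z => christoffel G z p q) y a) w
      = 1 / 2 * (fderiv ℝ (fderiv ℝ G) y a p q w + fderiv ℝ (fderiv ℝ G) y a q p w
        - fderiv ℝ (fderiv ℝ G) y a w p q) - fderiv ℝ G y a (christoffel G y p q) w := by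
    intro a p q w
    have hΓ : DifferentiableAt ℝ (fun z => christoffel G z p q) y :=
      (contDiffAt_christoffel hG h p q).differentiableAt (by simp)
    have e1 : HasFDerivAt (fun z => G z (christoffel G z p q) w) _ y :=
      (hd.hasFDerivAt.clm_apply hΓ.hasFDerivAt).clm_apply (hasFDerivAt_const w y)
    have e2 := (((hH p q w).add (hH q p w)).sub (hH w p q)).const_mul (1 / 2 : ℝ)
    have e3 : (fun z => G z (christoffel G z p q) w) =ᶠ[𝓝 y] fun z => 1 / 2 *
        (fderiv ℝ G z p q w + fderiv ℝ G z q p w - fderiv ℝ G z w p q) := by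
      filter_upwards [eventually_isInvertible hG.continuousAt h] with z hz
        using apply_christoffel hz p q w
    have := congrArg (fun L => L a) ((e1.congr_of_eventuallyEq e3.symm).unique e2)
    simp at this
    linarith
  have sy := hs.self_of_nhds
  have sS := hS.self_of_nhds
  have hc := fun p q w => apply_christoffel (z := y) h p q w
  simp only [riemannCurvature, map_add, map_sub, add_apply,
    sub_apply, key, hc]
  linarith [hHs u u v v, hHs v u v u, hHs u v v u, hHs v v u u, hHs v u u v,
    sS u (christoffel G y v v) u, sS v u (christoffel G y u v), sS u v (christoffel G y u v),
    sS (christoffel G y v v) u u, sS (christoffel G y u v) u v, sS v (christoffel G y u v) u]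

end CurvatureFormula

/-! ### Curvature of a warped product with a line -/

section WarpedForm

variable {E : Type*} [NormedAddCommGroup E] [NormedSpace ℝ E]

/-- The warped product `η dt² + f(t)² k` of a line with a field `k` of bilinear forms on `E`. -/
noncomputable def warpedForm (η : ℝ) (f : ℝ → ℝ) (k : E → E →L[ℝ] E →L[ℝ] ℝ) (z : ℝ × E) :
    (ℝ × E) →L[ℝ] (ℝ × E) →L[ℝ] ℝ :=
  η • pullbackForm (ContinuousLinearMap.mul ℝ ℝ) (ContinuousLinearMap.fst ℝ ℝ E)
    + f z.1 ^ 2 • pullbackForm (k z.2) (ContinuousLinearMap.snd ℝ ℝ E)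

theorem warpedForm_apply (η : ℝ) (f : ℝ → ℝ) (k : E → E →L[ℝ] E →L[ℝ] ℝ) (z u v : ℝ × E) :
    warpedForm η f k z u v = η * (u.1 * v.1) + f z.1 ^ 2 * k z.2 u.2 v.2 := by
  simp [warpedForm, pullbackForm]

theorem contDiffAt_warpedForm {η : ℝ} {f : ℝ → ℝ} {k : E → E →L[ℝ] E →L[ℝ] ℝ} {z : ℝ × E}
    (hf : ContDiffAt ℝ ∞ f z.1) (hk : ContDiffAt ℝ ∞ k z.2) :
    ContDiffAt ℝ ∞ (warpedForm η f k) z := by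
  have h1 : ContDiffAt ℝ ∞ (fun x : ℝ × E => f x.1) z := hf.comp z contDiffAt_fst
  have h2 : ContDiffAt ℝ ∞ (fun x : ℝ × E => k x.2) z := hk.comp z contDiffAt_snd
  unfold warpedForm pullbackForm
  exact contDiffAt_const.add ((h1.pow 2).smul
    (contDiffAt_const.clm_comp (h2.clm_comp contDiffAt_const)))

theorem eventually_differentiableAt {V W : Type*} [NormedAddCommGroup V] [NormedSpace ℝ V]
    [NormedAddCommGroup W] [NormedSpace ℝ W] {h : V → W} {x : V} (hh : ContDiffAt ℝ ∞ h x) :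
    ∀ᶠ z in 𝓝 x, DifferentiableAt ℝ h z :=
  ((hh.of_le (m := 1) (by simp)).eventually (by simp)).mono
    fun _ hz => hz.differentiableAt (by simp)

theorem isInvertible_of_nondegenerate [FiniteDimensional ℝ E] {B : E →L[ℝ] E →L[ℝ] ℝ}
    (h : ∀ u, (∀ v, B u v = 0) → u = 0) : B.IsInvertible := by
  have hi : Function.Injective (B : E →ₗ[ℝ] (E →L[ℝ] ℝ)) := by
    rw [← LinearMap.ker_eq_bot, LinearMap.ker_eq_bot']
    intro u hu
    exact h u fun v => by simpa using congrArg (fun L => L v) hu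
  have hd : Module.finrank ℝ E = Module.finrank ℝ (E →L[ℝ] ℝ) := by
    rw [← (LinearMap.toContinuousLinearMap (𝕜 := ℝ) (E := E) (F' := ℝ)).finrank_eq]
    exact (Subspace.dual_finrank_eq (K := ℝ) (V := E)).symm
  refine ⟨(LinearEquiv.ofInjectiveOfFinrankEq _ hi hd).toContinuousLinearEquiv, ?_⟩
  ext u v
  rfl

theorem warpedForm_nondegenerate {η : ℝ} (hη : η ≠ 0) {f : ℝ → ℝ} {k : E → E →L[ℝ] E →L[ℝ] ℝ}
    {z : ℝ × E} (hf : f z.1 ≠ 0) (hk : ∀ u, (∀ v, k z.2 u v = 0) → u = 0) (u : ℝ × E)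
    (hu : ∀ v, warpedForm η f k z u v = 0) : u = 0 := by
  simp only [warpedForm_apply] at hu
  refine Prod.ext ?_ (hk _ fun v => ?_)
  · simpa [hη] using hu (1, 0)
  · simpa [hf] using hu (0, v)

theorem contDiffAt_infty_deriv {f : ℝ → ℝ} {t : ℝ} (hf : ContDiffAt ℝ ∞ f t) :
    ContDiffAt ℝ ∞ (deriv f) t := by
  have := (hf.fderiv_right (m := ∞) (by simp)).clm_apply (contDiffAt_const (c := (1 : ℝ)))
  simpa only [fderiv_apply_one_eq_deriv] using this

theorem fderiv_warpedForm {η : ℝ} {f : ℝ → ℝ} {k : E → E →L[ℝ] E →L[ℝ] ℝ} {z : ℝ × E}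
    (hf : DifferentiableAt ℝ f z.1) (hk : DifferentiableAt ℝ k z.2) (w u v : ℝ × E) :
    fderiv ℝ (warpedForm η f k) z w u v
      = 2 * f z.1 * deriv f z.1 * w.1 * k z.2 u.2 v.2
        + f z.1 ^ 2 * fderiv ℝ k z.2 w.2 u.2 v.2 := by
  have hf' : HasFDerivAt (fun x : ℝ × E => f x.1) _ z :=
    hf.hasFDerivAt.comp z hasFDerivAt_fst
  have hk' : HasFDerivAt (fun x : ℝ × E => k x.2) _ z :=
    hk.hasFDerivAt.comp z hasFDerivAt_snd
  have hd : DifferentiableAt ℝ (warpedForm η f k) z := by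
    unfold warpedForm pullbackForm
    exact (differentiableAt_const _).add ((hf'.differentiableAt.pow 2).smul
      ((differentiableAt_const _).clm_comp
        (hk'.differentiableAt.clm_comp (differentiableAt_const _))))
  have e1 : HasFDerivAt (fun x => warpedForm η f k x u v) _ z :=
    (hd.hasFDerivAt.clm_apply (hasFDerivAt_const u z)).clm_apply (hasFDerivAt_const v z)
  have e2 : HasFDerivAt (fun x : ℝ × E => η * (u.1 * v.1) + f x.1 ^ 2 * k x.2 u.2 v.2) _ z :=
    (((hf'.pow 2)).mul ((hk'.clm_apply (hasFDerivAt_const u.2 z)).clm_apply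
      (hasFDerivAt_const v.2 z))).const_add (η * (u.1 * v.1))
  simp only [warpedForm_apply] at e1
  have := congrArg (fun L => L w) (e1.unique e2)
  have hw : fderiv ℝ f z.1 w.1 = w.1 * deriv f z.1 := by
    rw [← smul_eq_mul, ← fderiv_apply_one_eq_deriv, ← map_smul, smul_eq_mul, mul_one]
  simp [hw] at this
  rw [this]
  ring

theorem fderiv_fderiv_warpedForm {η : ℝ} {f : ℝ → ℝ} {k : E → E →L[ℝ] E →L[ℝ] ℝ} {z : ℝ × E}
    (hf : ContDiffAt ℝ ∞ f z.1) (hk : ContDiffAt ℝ ∞ k z.2) (s w u v : ℝ × E) :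
    fderiv ℝ (fderiv ℝ (warpedForm η f k)) z s w u v
      = 2 * (deriv f z.1 ^ 2 + f z.1 * deriv (deriv f) z.1) * s.1 * w.1 * k z.2 u.2 v.2
        + 2 * f z.1 * deriv f z.1 * (w.1 * fderiv ℝ k z.2 s.2 u.2 v.2
          + s.1 * fderiv ℝ k z.2 w.2 u.2 v.2)
        + f z.1 ^ 2 * fderiv ℝ (fderiv ℝ k) z.2 s.2 w.2 u.2 v.2 := by
  have hd := ((contDiffAt_warpedForm (η := η) hf hk).fderiv_right (m := ∞)
    (by simp)).differentiableAt (by simp)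
  have e1 : HasFDerivAt (fun x => fderiv ℝ (warpedForm η f k) x w u v) _ z :=
    ((hd.hasFDerivAt.clm_apply (hasFDerivAt_const w z)).clm_apply
      (hasFDerivAt_const u z)).clm_apply (hasFDerivAt_const v z)
  have hdf := contDiffAt_infty_deriv hf
  have hf' : HasFDerivAt (fun x : ℝ × E => f x.1) _ z :=
    (hf.differentiableAt (by simp)).hasFDerivAt.comp z hasFDerivAt_fst
  have hf'' : HasFDerivAt (fun x : ℝ × E => deriv f x.1) _ z :=
    (hdf.differentiableAt (by simp)).hasFDerivAt.comp z hasFDerivAt_fst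
  have hk' : HasFDerivAt (fun x : ℝ × E => k x.2) _ z :=
    (hk.differentiableAt (by simp)).hasFDerivAt.comp z hasFDerivAt_snd
  have hk'' : HasFDerivAt (fun x : ℝ × E => fderiv ℝ k x.2) _ z :=
    ((hk.fderiv_right (m := ∞) (by simp)).differentiableAt
      (by simp)).hasFDerivAt.comp z hasFDerivAt_snd
  have e2 : HasFDerivAt (fun x : ℝ × E => 2 * (f x.1 * deriv f x.1 * (w.1 * k x.2 u.2 v.2))
      + f x.1 ^ 2 * fderiv ℝ k x.2 w.2 u.2 v.2) _ z :=
    (((hf'.mul hf'').mul (((hk'.clm_apply (hasFDerivAt_const u.2 z)).clm_apply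
      (hasFDerivAt_const v.2 z)).const_mul w.1)).const_mul 2).add
    ((hf'.pow 2).mul (((hk''.clm_apply (hasFDerivAt_const w.2 z)).clm_apply
      (hasFDerivAt_const u.2 z)).clm_apply (hasFDerivAt_const v.2 z)))
  have n1 : ∀ᶠ x : ℝ × E in 𝓝 z, DifferentiableAt ℝ f x.1 :=
    continuousAt_fst.eventually (eventually_differentiableAt hf)
  have n2 : ∀ᶠ x : ℝ × E in 𝓝 z, DifferentiableAt ℝ k x.2 :=
    continuousAt_snd.eventually (eventually_differentiableAt hk)
  have e3 : (fun x => fderiv ℝ (warpedForm η f k) x w u v) =ᶠ[𝓝 z]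
      fun x : ℝ × E => 2 * (f x.1 * deriv f x.1 * (w.1 * k x.2 u.2 v.2))
      + f x.1 ^ 2 * fderiv ℝ k x.2 w.2 u.2 v.2 := by
    filter_upwards [n1, n2] with x h1 h2
    rw [fderiv_warpedForm h1 h2]
    ring
  have := congrArg (fun L => L s) ((e1.congr_of_eventuallyEq e3.symm).unique e2)
  have hw : ∀ (g : ℝ → ℝ) (r : ℝ), fderiv ℝ g z.1 r = r * deriv g z.1 := by
    intro g r
    rw [← smul_eq_mul, ← fderiv_apply_one_eq_deriv, ← map_smul, smul_eq_mul, mul_one]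
  simp [hw] at this
  rw [this]
  ring

theorem christoffel_warpedForm [FiniteDimensional ℝ E] {η : ℝ} (hη : η ^ 2 = 1) {f : ℝ → ℝ}
    {k : E → E →L[ℝ] E →L[ℝ] ℝ} {z : ℝ × E} (hf : DifferentiableAt ℝ f z.1)
    (hk : DifferentiableAt ℝ k z.2) (hfz : f z.1 ≠ 0) (hkz : ∀ u, (∀ v, k z.2 u v = 0) → u = 0)
    (u v : ℝ × E) :
    christoffel (warpedForm η f k) z u v
      = (-(η * f z.1 * deriv f z.1 * k z.2 u.2 v.2), christoffel k z.2 u.2 v.2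
          + (deriv f z.1 / f z.1) • (u.1 • v.2 + v.1 • u.2)) := by
  have hη0 : η ≠ 0 := by rintro rfl; norm_num at hη
  refine christoffel_eq (isInvertible_of_nondegenerate
    (warpedForm_nondegenerate hη0 hfz hkz)) fun w => ?_
  simp only [fderiv_warpedForm hf hk, warpedForm_apply, map_add, map_smul, add_apply,
    smul_apply, smul_eq_mul, apply_christoffel (isInvertible_of_nondegenerate hkz)]
  field_simp
  linear_combination (-2 * deriv f z.1 * k z.2 u.2 v.2 * w.1) * hη

/-- The bivector `u ∧ v` splits into a mixed part, given by `u₁ v₂ - v₁ u₂`, and a fibre part `u₂ ∧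
v₂`. No cross term between them appears: the mixed part carries `-f f''`, the fibre part the
curvature of the fibre corrected by `-η f'²`, which comes from the bending of the slices. -/
theorem apply_riemannCurvature_warpedForm [FiniteDimensional ℝ E] {η : ℝ} (hη : η ^ 2 = 1)
    {f : ℝ → ℝ} {k : E → E →L[ℝ] E →L[ℝ] ℝ} {z : ℝ × E} (hf : ContDiffAt ℝ ∞ f z.1)
    (hk : ContDiffAt ℝ ∞ k z.2) (hfz : f z.1 ≠ 0) (hkz : ∀ u, (∀ v, k z.2 u v = 0) → u = 0)
    (hs : ∀ᶠ y in 𝓝 z.2, ∀ a b, k y a b = k y b a) (u v : ℝ × E) :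
    warpedForm η f k z (riemannCurvature (warpedForm η f k) z u v v) u
      = f z.1 ^ 2 * k z.2 (riemannCurvature k z.2 u.2 v.2 v.2) u.2
        - f z.1 * deriv (deriv f) z.1 * k z.2 (u.1 • v.2 - v.1 • u.2) (u.1 • v.2 - v.1 • u.2)
        - η * f z.1 ^ 2 * deriv f z.1 ^ 2
          * (k z.2 u.2 u.2 * k z.2 v.2 v.2 - k z.2 u.2 v.2 ^ 2) := by
  have hη0 : η ≠ 0 := by rintro rfl; norm_num at hη
  have hi := isInvertible_of_nondegenerate hkz
  have hs' : ∀ᶠ x in 𝓝 z, ∀ a b, warpedForm η f k x a b = warpedForm η f k x b a := by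
    filter_upwards [continuousAt_snd.eventually hs] with x hx a b
    rw [warpedForm_apply, warpedForm_apply, hx, mul_comm a.1]
  have hfd := hf.differentiableAt (by simp)
  have hkd := hk.differentiableAt (by simp)
  rw [apply_riemannCurvature (contDiffAt_warpedForm hf hk) (isInvertible_of_nondegenerate
    (warpedForm_nondegenerate hη0 hfz hkz)) hs', apply_riemannCurvature hk hi hs]
  have c : ∀ p q w, k z.2 w (christoffel k z.2 p q)
      = 1 / 2 * (fderiv ℝ k z.2 p q w + fderiv ℝ k z.2 q p w - fderiv ℝ k z.2 w p q) := by
    intro p q w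
    rw [hs.self_of_nhds, apply_christoffel hi]
  have c' := fun p q w => apply_christoffel (z := z.2) hi p q w
  have sS := fun u a b => fderiv_apply_symm hkd hs u a b
  have sy := hs.self_of_nhds
  simp only [fderiv_fderiv_warpedForm hf hk, christoffel_warpedForm hη hfd hkd hfz hkz,
    warpedForm_apply, map_add, map_sub, map_smul, add_apply, sub_apply, smul_apply, smul_eq_mul]
  -- The terms quadratic in the Christoffel symbols of `k` occur alike on both sides; freezing them
  -- lets the Koszul formula expand only the linear ones.
  generalize h1 : k z.2 (christoffel k z.2 u.2 v.2) (christoffel k z.2 u.2 v.2) = A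
  generalize h2 : k z.2 (christoffel k z.2 u.2 u.2) (christoffel k z.2 v.2 v.2) = A'
  simp only [c, c']
  rw [sy v.2 u.2, sS v.2 v.2 u.2, sS u.2 v.2 u.2]
  field_simp
  linear_combination (2 * f z.1 ^ 2 * deriv f z.1 ^ 2 * η *
    (k z.2 u.2 v.2 ^ 2 - k z.2 u.2 u.2 * k z.2 v.2 v.2)) * hη

/-- If all nondegenerate planes have sectional curvature `c`, the curvature form is the one of
constant curvature also on degenerate planes. -/
theorem apply_riemannCurvature_eq_of_forall_nondegenerate [FiniteDimensional ℝ E]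
    {k : E → E →L[ℝ] E →L[ℝ] ℝ} {y : E} {c : ℝ} (hk : ContDiffAt ℝ ∞ k y)
    (hky : (k y).IsInvertible) (hs : ∀ᶠ x in 𝓝 y, ∀ a b, k x a b = k x b a)
    {u₀ v₀ : E} (h₀ : k y u₀ u₀ * k y v₀ v₀ - k y u₀ v₀ ^ 2 ≠ 0)
    (h : ∀ u v, k y u u * k y v v - k y u v ^ 2 ≠ 0 →
      k y (riemannCurvature k y u v v) u = c * (k y u u * k y v v - k y u v ^ 2)) (u v : E) :
    k y (riemannCurvature k y u v v) u = c * (k y u u * k y v v - k y u v ^ 2) := by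
  have sy := hs.self_of_nhds
  -- Join the nondegenerate pair `(u₀, v₀)` at `r = 0` to `(u, v)` at `r = 1` by a segment. `Δ` is a
  -- polynomial in `r` with `Δ 0 ≠ 0`, so it has finitely many zeros; the desired identity holds off
  -- them, hence everywhere by continuity.
  let Δ : ℝ → ℝ := fun r => k y (u₀ + r • (u - u₀)) (u₀ + r • (u - u₀)) * k y (v₀ + r • (v - v₀)) (v₀ + r • (v - v₀))
    - k y (u₀ + r • (u - u₀)) (v₀ + r • (v - v₀)) ^ 2
  let Φ : ℝ → ℝ := fun r =>
    k y (riemannCurvature k y (u₀ + r • (u - u₀)) (v₀ + r • (v - v₀)) (v₀ + r • (v - v₀))) (u₀ + r • (u - u₀))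
  have hΔ : Continuous Δ := by fun_prop
  have hΦ : Continuous Φ := by
    simp only [Φ, apply_riemannCurvature hk hky hs]
    have hc : ∀ p q p' q' : E,
        Continuous fun r : ℝ => christoffel k y (p + r • q) (p' + r • q') := by
      intro p q p' q'
      simp only [christoffel]
      have h3 : ∀ r : ℝ, ((fderiv ℝ k y).flip (p + r • q)).flip (p' + r • q')
        = ((fderiv ℝ k y).flip p).flip p' + r • ((fderiv ℝ k y).flip q).flip p'
          + r • (((fderiv ℝ k y).flip p).flip q' + r • ((fderiv ℝ k y).flip q).flip q') := by
        intro r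
        ext w
        simp
        ring
      simp only [h3]
      fun_prop
    fun_prop (disch := exact hc _ _ _ _)
  obtain ⟨P, hP, hP0⟩ : ∃ P : Polynomial ℝ, (∀ r, P.eval r = Δ r) ∧ P ≠ 0 := by
    let q : E → E → E → E → Polynomial ℝ := fun a b a' b' =>
      .C (k y a b) + .C (k y a b' + k y a' b) * .X + .C (k y a' b') * .X ^ 2
    have hq : ∀ r, (q u₀ u₀ (u - u₀) (u - u₀) * q v₀ v₀ (v - v₀) (v - v₀)
        - q u₀ v₀ (u - u₀) (v - v₀) ^ 2).eval r = Δ r := by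
      intro r
      simp [q, Δ]
      ring
    refine ⟨_, hq, fun h => h₀ ?_⟩
    have := hq 0
    rw [h] at this
    simpa [Δ] using this.symm
  have hfin : {r | Δ r = 0}.Finite := by
    refine (P.finite_setOfPred_isRoot hP0).subset fun r hr => ?_
    simpa [Polynomial.IsRoot, hP] using hr
  have hdense : Dense {r | Δ r = 0}ᶜ := Set.Countable.dense_compl ℝ hfin.countable
  have : Φ = fun r => c * Δ r := by
    refine hΦ.ext_on hdense (by fun_prop) fun r hr => h _ _ hr
  simpa [Φ, Δ] using congrFun this 1

end WarpedForm

/-! ### The Gauss equation for immersions into a flat space -/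

section Gauss

theorem minSmoothness_two_le_infty : minSmoothness ℝ 2 ≤ ∞ := by
  rw [minSmoothness_of_isRCLikeNormedField]
  exact WithTop.coe_le_coe.2 (le_top (a := (2 : ℕ∞)))

variable {V W : Type*} [NormedAddCommGroup V] [NormedSpace ℝ V]
  [NormedAddCommGroup W] [NormedSpace ℝ W]

theorem fderiv_inducedForm {B : W →L[ℝ] W →L[ℝ] ℝ}
    {φ : V → W} {G : V → V →L[ℝ] V →L[ℝ] ℝ} {z : V} (hφ : DifferentiableAt ℝ (fderiv ℝ φ) z)
    (hGd : DifferentiableAt ℝ G z)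
    (hG : ∀ᶠ x in 𝓝 z, ∀ a b, G x a b = B (fderiv ℝ φ x a) (fderiv ℝ φ x b)) (u a b : V) :
    fderiv ℝ G z u a b = B (fderiv ℝ (fderiv ℝ φ) z u a) (fderiv ℝ φ z b)
      + B (fderiv ℝ φ z a) (fderiv ℝ (fderiv ℝ φ) z u b) := by
  have h1 : HasFDerivAt (fun x => G x a b) _ z :=
    (hGd.hasFDerivAt.clm_apply (hasFDerivAt_const a z)).clm_apply (hasFDerivAt_const b z)
  have hd := hφ.hasFDerivAt
  have h2 : HasFDerivAt (fun x => B (fderiv ℝ φ x a) (fderiv ℝ φ x b)) _ z :=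
    (B.hasFDerivAt.comp z (hd.clm_apply (hasFDerivAt_const a z))).clm_apply
      (hd.clm_apply (hasFDerivAt_const b z))
  have h3 : (fun x => G x a b) =ᶠ[𝓝 z] fun x => B (fderiv ℝ φ x a) (fderiv ℝ φ x b) := by
    filter_upwards [hG] with x hx using hx a b
  have := congrArg (fun L => L u) ((h1.congr_of_eventuallyEq h3.symm).unique h2)
  simp at this
  linarith

theorem eventually_contDiffAt {h : V → W} {x : V} (hh : ContDiffAt ℝ ∞ h x) (n : ℕ) :
    ∀ᶠ z in 𝓝 x, ContDiffAt ℝ n h z :=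
  (hh.of_le (m := n) (mod_cast le_top)).eventually (by simp)

theorem contDiffAt_of_eventually_inducedForm [FiniteDimensional ℝ V] {B : W →L[ℝ] W →L[ℝ] ℝ}
    {φ : V → W} {G : V → V →L[ℝ] V →L[ℝ] ℝ} {z : V} (hφ : ContDiffAt ℝ ∞ φ z)
    (hG : ∀ᶠ x in 𝓝 z, ∀ a b, G x a b = B (fderiv ℝ φ x a) (fderiv ℝ φ x b)) :
    ContDiffAt ℝ ∞ G z := by
  have h1 : ContDiffAt ℝ ∞ (fun x => pullbackForm B (fderiv ℝ φ x)) z := by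
    have hd := hφ.fderiv_right (m := ∞) (by simp)
    unfold pullbackForm
    refine ContDiffAt.clm_comp ?_ (contDiffAt_const.clm_comp hd)
    have := ((ContinuousLinearMap.compL ℝ V W ℝ).flip).contDiff (n := ∞)
    exact this.contDiffAt.comp z hd
  refine h1.congr_of_eventuallyEq ?_
  filter_upwards [hG] with x hx
  ext a b
  simp [pullbackForm, hx]

variable [FiniteDimensional ℝ V]

/-- Substituting the derivatives of the induced metric into the Koszul formula, all terms but one
cancel by symmetry of `D²φ`. So `Dφ(Γ)` is the tangential part of `D²φ`, and the difference is the
second fundamental form. -/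
theorem apply_fderiv_fderiv_eq {B : W →L[ℝ] W →L[ℝ] ℝ} (hB : ∀ x y, B x y = B y x)
    {φ : V → W} {G : V → V →L[ℝ] V →L[ℝ] ℝ} {y : V} (hφ : ContDiffAt ℝ ∞ φ y)
    (hG : ∀ᶠ x in 𝓝 y, ∀ a b, G x a b = B (fderiv ℝ φ x a) (fderiv ℝ φ x b))
    (hi : (G y).IsInvertible) (u v w : V) :
    B (fderiv ℝ (fderiv ℝ φ) y u v - fderiv ℝ φ y (christoffel G y u v)) (fderiv ℝ φ y w) = 0 := by
  have hGd := (contDiffAt_of_eventually_inducedForm hφ hG).differentiableAt (by simp)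
  have hsym := hφ.isSymmSndFDerivAt minSmoothness_two_le_infty
  rw [map_sub, sub_apply, ← hG.self_of_nhds, apply_christoffel hi]
  have hd := (hφ.fderiv_right (m := ∞) (by simp)).differentiableAt (by simp)
  simp only [fderiv_inducedForm hd hGd hG]
  rw [hsym.eq v u, hsym.eq w u, hsym.eq w v, hB (fderiv ℝ φ y v), hB (fderiv ℝ φ y u),
    hB (fderiv ℝ (fderiv ℝ φ) y u w)]
  ring

/-- The Gauss equation for an isometric immersion into a flat space. -/
theorem gauss_equation {B : W →L[ℝ] W →L[ℝ] ℝ} (hB : ∀ x y, B x y = B y x)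
    {φ : V → W} {G : V → V →L[ℝ] V →L[ℝ] ℝ} {y : V} (hφ : ContDiffAt ℝ ∞ φ y)
    (hG : ∀ᶠ x in 𝓝 y, ∀ a b, G x a b = B (fderiv ℝ φ x a) (fderiv ℝ φ x b))
    (hi : (G y).IsInvertible) {σ : V → V → W}
    (hσ : ∀ u v, σ u v = fderiv ℝ (fderiv ℝ φ) y u v - fderiv ℝ φ y (christoffel G y u v))
    (u v : V) :
    G y (riemannCurvature G y u v v) u = B (σ u u) (σ v v) - B (σ u v) (σ u v) := by
  have hGc := contDiffAt_of_eventually_inducedForm hφ hG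
  have hGd := hGc.differentiableAt (by simp)
  have hs : ∀ᶠ x in 𝓝 y, ∀ a b, G x a b = G x b a := by
    filter_upwards [hG] with x hx a b
    rw [hx, hx, hB]
  have hd := hφ.fderiv_right (m := ∞) (by simp)
  have hd2 := hd.fderiv_right (m := ∞) (by simp)
  have hsym := hφ.isSymmSndFDerivAt minSmoothness_two_le_infty
  have hsym3 := hd.isSymmSndFDerivAt minSmoothness_two_le_infty
  have hD1 := (hd.differentiableAt (by simp)).hasFDerivAt
  have hD2 := (hd2.differentiableAt (by simp)).hasFDerivAt
  have hev : ∀ᶠ x in 𝓝 y, ∀ a b,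
      fderiv ℝ (fderiv ℝ φ) x a b = fderiv ℝ (fderiv ℝ φ) x b a := by
    filter_upwards [eventually_contDiffAt hφ 2] with x hx a b
    exact (hx.isSymmSndFDerivAt (by simp)).eq a b
  have hT : ∀ a b c, fderiv ℝ (fderiv ℝ (fderiv ℝ φ)) y a b c
      = fderiv ℝ (fderiv ℝ (fderiv ℝ φ)) y a c b := by
    intro a b c
    have e : ∀ b c, HasFDerivAt (fun x => fderiv ℝ (fderiv ℝ φ) x b c) _ y := fun b c =>
      (hD2.clm_apply (hasFDerivAt_const b y)).clm_apply (hasFDerivAt_const c y)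
    have h2 : (fun x => fderiv ℝ (fderiv ℝ φ) x b c) =ᶠ[𝓝 y]
        fun x => fderiv ℝ (fderiv ℝ φ) x c b := by
      filter_upwards [hev] with x hx using hx b c
    have := ((e b c).congr_of_eventuallyEq h2.symm).unique (e c b)
    simpa using congrArg (fun L => L a) this
  have key : ∀ s u a b, fderiv ℝ (fderiv ℝ G) y s u a b
      = B (fderiv ℝ (fderiv ℝ (fderiv ℝ φ)) y s u a) (fderiv ℝ φ y b)
        + B (fderiv ℝ (fderiv ℝ φ) y u a) (fderiv ℝ (fderiv ℝ φ) y s b)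
        + B (fderiv ℝ (fderiv ℝ φ) y s a) (fderiv ℝ (fderiv ℝ φ) y u b)
        + B (fderiv ℝ φ y a) (fderiv ℝ (fderiv ℝ (fderiv ℝ φ)) y s u b) := by
    intro s u a b
    have hG2 := ((hGc.fderiv_right (m := ∞) (by simp)).differentiableAt (by simp)).hasFDerivAt
    have h1 : HasFDerivAt (fun x => fderiv ℝ G x u a b) _ y :=
      ((hG2.clm_apply (hasFDerivAt_const u y)).clm_apply
        (hasFDerivAt_const a y)).clm_apply (hasFDerivAt_const b y)
    have c1 : ∀ a, HasFDerivAt (fun x => fderiv ℝ φ x a) _ y := fun a =>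
      hD1.clm_apply (hasFDerivAt_const a y)
    have c2 : ∀ a, HasFDerivAt (fun x => fderiv ℝ (fderiv ℝ φ) x u a) _ y := fun a =>
      (hD2.clm_apply (hasFDerivAt_const u y)).clm_apply (hasFDerivAt_const a y)
    have h2 : HasFDerivAt (fun x => B (fderiv ℝ (fderiv ℝ φ) x u a) (fderiv ℝ φ x b)
        + B (fderiv ℝ φ x a) (fderiv ℝ (fderiv ℝ φ) x u b)) _ y :=
      ((B.hasFDerivAt.comp y (c2 a)).clm_apply (c1 b)).add
        ((B.hasFDerivAt.comp y (c1 a)).clm_apply (c2 b))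
    have h3 : (fun x => fderiv ℝ G x u a b) =ᶠ[𝓝 y]
        fun x => B (fderiv ℝ (fderiv ℝ φ) x u a) (fderiv ℝ φ x b)
        + B (fderiv ℝ φ x a) (fderiv ℝ (fderiv ℝ φ) x u b) := by
      filter_upwards [hG.eventually_nhds, eventually_differentiableAt hd,
        eventually_differentiableAt hGc] with x hx h2 h4 using fderiv_inducedForm h2 h4 hx u a b
    have := congrArg (fun L => L s) ((h1.congr_of_eventuallyEq h3.symm).unique h2)
    simp at this
    linarith
  rw [apply_riemannCurvature hGc hi hs]
  have o := apply_fderiv_fderiv_eq hB hφ hG hi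
  have ho : ∀ a b c d, B (σ a b) (σ c d)
      = B (fderiv ℝ (fderiv ℝ φ) y a b) (fderiv ℝ (fderiv ℝ φ) y c d)
        - G y (christoffel G y a b) (christoffel G y c d) := by
    intro a b c d
    have o1 := o a b (christoffel G y c d)
    have o2 := o c d (christoffel G y a b)
    rw [hB] at o2
    simp only [hσ, hG.self_of_nhds, map_sub, sub_apply] at o1 o2 ⊢
    linarith
  rw [ho, ho]
  simp only [key]
  -- The curvature formula involves second derivatives of the metric, hence third derivatives of
  -- `φ`; the total symmetry of `D³φ` makes them cancel.
  have h5 : fderiv ℝ (fderiv ℝ (fderiv ℝ φ)) y u v v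
      = fderiv ℝ (fderiv ℝ (fderiv ℝ φ)) y v v u := by
    rw [hsym3.eq u v, hT v u v]
  rw [hT u v u, h5, hsym.eq v u]
  rw [hB (fderiv ℝ φ y v), hB (fderiv ℝ φ y u)]
  ring

end Gauss

/-! ### Linear algebra of the Gauss equation -/

section AlgebraicGauss

variable {V : Type*} [NormedAddCommGroup V] [NormedSpace ℝ V] [FiniteDimensional ℝ V]

theorem exists_orthogonal_basis_of_nondegenerate {G : V →L[ℝ] V →L[ℝ] ℝ}
    (hs : ∀ x y, G x y = G y x) (hG : ∀ x, (∀ y, G x y = 0) → x = 0) :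
    ∃ v : Module.Basis (Fin (Module.finrank ℝ V)) ℝ V,
      (∀ i j, i ≠ j → G (v i) (v j) = 0) ∧ ∀ i, G (v i) (v i) ≠ 0 := by
  let B : LinearMap.BilinForm ℝ V := LinearMap.mk₂ ℝ (fun x y => G x y)
    (by simp) (by simp) (by simp) (by simp)
  obtain ⟨v, hv⟩ := LinearMap.BilinForm.exists_orthogonal_basis (B := B)
    ⟨fun x y => by simp [B, hs x y]⟩
  have hv' : ∀ i j, i ≠ j → G (v i) (v j) = 0 := fun i j hij => hv hij
  refine ⟨v, hv', fun i hi => v.ne_zero i (hG _ fun y => ?_)⟩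
  rw [← v.sum_repr y]
  simp only [map_sum, map_smul, smul_eq_mul]
  refine Finset.sum_eq_zero fun j _ => ?_
  by_cases h : i = j
  · subst h; simp [hi]
  · simp [hv' i j h]

theorem exists_nondegenerate_plane {G : V →L[ℝ] V →L[ℝ] ℝ}
    (hs : ∀ x y, G x y = G y x) (hG : ∀ x, (∀ y, G x y = 0) → x = 0)
    (hd : 2 ≤ Module.finrank ℝ V) :
    ∃ x y, G x x ≠ 0 ∧ G y y ≠ 0 ∧ G x y = 0 := by
  obtain ⟨v, h1, h2⟩ := exists_orthogonal_basis_of_nondegenerate hs hG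
  exact ⟨v ⟨0, by omega⟩, v ⟨1, by omega⟩, h2 _, h2 _, h1 _ _ (by simp)⟩

variable {G h : V →L[ℝ] V →L[ℝ] ℝ} {l : V →L[ℝ] ℝ} {e b k₁ k₂ : ℝ}

/-- Here `h`, `l`, `b` are the fibre, mixed and `∂_t` components of the second fundamental form, `G`
the fibre metric and `e` the square of the normal. If `l x ≠ 0`, then `H3` makes `h` a multiple of
`l ⊗ l`. Its rank is at most one, so `k₂ = 0` by `H2`; then `k₁ ≠ 0`, and `H1` makes `G` itself a
multiple of `l ⊗ l`, which is impossible for a nondegenerate form in dimension at least 2. -/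
theorem mixed_part_eq_zero
    (hs : ∀ x y, G x y = G y x) (hG : ∀ x, (∀ y, G x y = 0) → x = 0)
    (hd : 2 ≤ Module.finrank ℝ V) (hh : ∀ x y, h x y = h y x)
    (H1 : ∀ y, e * (b * h y y - l y ^ 2) = k₁ * G y y)
    (H2 : ∀ x y, e * (h x x * h y y - h x y ^ 2) = k₂ * (G x x * G y y - G x y ^ 2))
    (H3 : ∀ x y, l x * h y y = l y * h x y) (hk : k₁ ≠ 0 ∨ k₂ ≠ 0) (x : V) : l x = 0 := by
  by_contra hx
  obtain ⟨y, z, hy, hz, hyz⟩ := exists_nondegenerate_plane hs hG hd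
  have p : ∀ w y z, 2 * (l w * h y z) = l y * h w z + l z * h w y := by
    intro w y z
    have := H3 w (y + z)
    simp only [map_add, add_apply] at this
    linarith [H3 w y, H3 w z, congrArg (fun r => l w * r) (hh y z)]
  have q : ∀ y, l x * h x y = l y * h x x := by
    intro y
    have := p x y x
    rw [hh y x] at this
    linarith
  have r : ∀ y z, l x ^ 2 * h y z = l y * l z * h x x := by
    intro y z
    linear_combination l x / 2 * p x y z + l y / 2 * q z + l z / 2 * q y
  have hx2 : l x ^ 2 ≠ 0 := pow_ne_zero 2 hx
  have k2 : k₂ = 0 := by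
    have : l x ^ 4 * (h y y * h z z - h y z ^ 2) = 0 := by
      linear_combination (l x ^ 2 * h z z) * r y y + (l y * l y * h x x) * r z z
        - (l x ^ 2 * h y z + l y * l z * h x x) * r y z
    have h0 : h y y * h z z - h y z ^ 2 = 0 :=
      (mul_eq_zero.1 this).resolve_left (pow_ne_zero 4 hx)
    have := H2 y z
    rw [h0, hyz] at this
    have h1 : G y y * G z z ≠ 0 := mul_ne_zero hy hz
    have : k₂ * (G y y * G z z) = 0 := by linarith
    exact (mul_eq_zero.1 this).resolve_right h1
  have k1 : k₁ ≠ 0 := hk.resolve_right (not_not.2 k2)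
  have s : ∀ y z, l x ^ 2 * (k₁ * G y z) = e * (b * h x x - l x ^ 2) * (l y * l z) := by
    intro y z
    have hp : k₁ * G y z = e * (b * h y z - l y * l z) := by
      have := H1 (y + z)
      simp only [map_add, add_apply] at this
      linear_combination -this / 2 + H1 y / 2 + H1 z / 2 + k₁ / 2 * hs y z - e * b / 2 * hh y z
    linear_combination l x ^ 2 * hp + e * b * r y z
  have hyy := s y y
  have hzz := s z z
  have hyz' := s y z
  rw [hyz, mul_zero, mul_zero] at hyz'
  have n1 : e * (b * h x x - l x ^ 2) * (l y * l y) ≠ 0 := by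
    rw [← hyy]; exact mul_ne_zero hx2 (mul_ne_zero k1 hy)
  have n2 : e * (b * h x x - l x ^ 2) * (l z * l z) ≠ 0 := by
    rw [← hzz]; exact mul_ne_zero hx2 (mul_ne_zero k1 hz)
  have m1 := left_ne_zero_of_mul n1
  have m2 := left_ne_zero_of_mul (right_ne_zero_of_mul n1)
  have m3 := left_ne_zero_of_mul (right_ne_zero_of_mul n2)
  exact mul_ne_zero m1 (mul_ne_zero m2 m3) hyz'.symm

/-- With `l = 0`, the mixed equation `H1` reads `e b h = k₁ G` on the diagonal; `k₁ ≠ 0` forces `b ≠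
0`, and polarization gives `h`. -/
theorem umbilic_of_mixed_ne_zero
    (hs : ∀ x y, G x y = G y x) (hG : ∀ x, (∀ y, G x y = 0) → x = 0)
    (hd : 2 ≤ Module.finrank ℝ V) (hh : ∀ x y, h x y = h y x) (he : e ≠ 0)
    (H1 : ∀ y, e * (b * h y y) = k₁ * G y y)
    (H2 : ∀ x y, e * (h x x * h y y - h x y ^ 2) = k₂ * (G x x * G y y - G x y ^ 2))
    (hk : k₁ ≠ 0) : k₂ ≠ 0 ∧ ∃ r, (∀ x y, h x y = r * G x y) ∧ e * r ^ 2 = k₂ := by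
  obtain ⟨y, z, hy, hz, hyz⟩ := exists_nondegenerate_plane hs hG hd
  have hb : b ≠ 0 := by
    rintro rfl
    have := H1 y
    rw [zero_mul, mul_zero] at this
    exact mul_ne_zero hk hy this.symm
  have hr : ∀ x y, h x y = k₁ / (e * b) * G x y := by
    intro x y
    have := H1 (x + y)
    simp only [map_add, add_apply] at this
    field_simp
    linear_combination this / 2 - H1 x / 2 - H1 y / 2 + e * b / 2 * hh x y - k₁ / 2 * hs x y
  have h1 : G y y * G z z ≠ 0 := mul_ne_zero hy hz
  have e1 : e * (k₁ / (e * b)) ^ 2 = k₂ := by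
    have := H2 y z
    rw [hr, hr, hr, hyz] at this
    apply mul_right_cancel₀ h1
    linear_combination this
  exact ⟨e1 ▸ mul_ne_zero he (pow_ne_zero 2 (div_ne_zero hk (mul_ne_zero he hb))), _, hr, e1⟩

/-- This is the rigidity of a second fundamental form of rank at least 3. In a `G`-orthogonal basis,
a third index kills the off-diagonal entries of `h` and then equates the ratios of the diagonal
entries of `h` and `G`. -/
theorem umbilic_of_three_le
    (hs : ∀ x y, G x y = G y x) (hG : ∀ x, (∀ y, G x y = 0) → x = 0)
    (hd : 3 ≤ Module.finrank ℝ V) (hh : ∀ x y, h x y = h y x) (he : e ≠ 0)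
    (H2 : ∀ x y, e * (h x x * h y y - h x y ^ 2) = k₂ * (G x x * G y y - G x y ^ 2))
    (hk : k₂ ≠ 0) : ∃ r, (∀ x y, h x y = r * G x y) ∧ e * r ^ 2 = k₂ := by
  obtain ⟨v, h1, h2⟩ := exists_orthogonal_basis_of_nondegenerate hs hG
  -- Polarization of `H2` in its second argument.
  have P : ∀ x y z, e * (h x x * h y z - h x y * h x z)
      = k₂ * (G x x * G y z - G x y * G x z) := by
    intro x y z
    have := H2 x (y + z)
    simp only [map_add, add_apply] at this
    linear_combination this / 2 - H2 x y / 2 - H2 x z / 2 + e / 2 * h x x * hh y z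
      - k₂ / 2 * G x x * hs y z
  have third : ∀ i j : Fin (Module.finrank ℝ V), ∃ k, k ≠ i ∧ k ≠ j := by
    intro i j
    have : ({i, j} : Finset (Fin (Module.finrank ℝ V))).card < Fintype.card
        (Fin (Module.finrank ℝ V)) := by
      rw [Fintype.card_fin]
      exact lt_of_le_of_lt Finset.card_le_two hd
    obtain ⟨k, hk⟩ := Finset.exists_mem_notMem_of_card_lt_card (t := Finset.univ) this
    simp at hk
    exact ⟨k, hk⟩
  have pd : ∀ i j, i ≠ j → e * (h (v i) (v i) * h (v j) (v j) - h (v i) (v j) ^ 2)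
      = k₂ * (G (v i) (v i) * G (v j) (v j)) := by
    intro i j hij
    rw [H2, h1 i j hij]; ring
  have off : ∀ i j, i ≠ j → h (v i) (v j) = 0 := by
    intro j k hjk
    obtain ⟨i, hij, hik⟩ := third j k
    have e1 := P (v i) (v j) (v k)
    have e2 := P (v j) (v i) (v k)
    rw [h1 j k hjk, h1 i j hij] at e1
    rw [h1 j k hjk, h1 i k hik] at e2
    have e3 := pd i j hij
    rw [hh (v j) (v i)] at e2
    -- `e1` and `e2` form a homogeneous linear system in `h_jk`, `h_ik`, whose determinant is
    -- nonzero by `e3`.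
    have : k₂ * (G (v i) (v i) * G (v j) (v j)) * h (v j) (v k) = 0 := by
      linear_combination -h (v j) (v k) * e3 + h (v j) (v j) * e1 + h (v i) (v j) * e2
    exact (mul_eq_zero.1 this).resolve_left (mul_ne_zero hk (mul_ne_zero (h2 i) (h2 j)))
  have dg : ∀ i j, i ≠ j → e * (h (v i) (v i) * h (v j) (v j))
      = k₂ * (G (v i) (v i) * G (v j) (v j)) := by
    intro i j hij
    rw [← pd i j hij, off i j hij]; ring
  have hne : ∀ i, h (v i) (v i) ≠ 0 := by
    intro i h0
    obtain ⟨j, hj, -⟩ := third i i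
    have := dg i j hj.symm
    rw [h0, zero_mul, mul_zero] at this
    exact mul_ne_zero hk (mul_ne_zero (h2 i) (h2 j)) this.symm
  have ratio : ∀ i j, h (v i) (v i) * G (v j) (v j) = h (v j) (v j) * G (v i) (v i) := by
    intro i j
    by_cases hij : i = j
    · subst hij; rfl
    obtain ⟨k, hki, hkj⟩ := third i j
    have a1 := dg i k hki.symm
    have a2 := dg j k hkj.symm
    have : (e * h (v k) (v k)) * (h (v i) (v i) * G (v j) (v j))
        = (e * h (v k) (v k)) * (h (v j) (v j) * G (v i) (v i)) := by
      linear_combination G (v j) (v j) * a1 - G (v i) (v i) * a2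
    exact mul_left_cancel₀ (mul_ne_zero he (hne k)) this
  let i₀ : Fin (Module.finrank ℝ V) := ⟨0, by omega⟩
  obtain ⟨j, hj, -⟩ := third i₀ i₀
  set r := h (v i₀) (v i₀) / G (v i₀) (v i₀) with hr
  have hdiag : ∀ i, h (v i) (v i) = r * G (v i) (v i) := by
    intro i
    have := h2 i₀
    rw [hr]
    field_simp
    linear_combination ratio i i₀
  refine ⟨r, fun x y => ?_, ?_⟩
  · have : (h : V →ₗ[ℝ] V →L[ℝ] ℝ) = ((r • G : V →L[ℝ] V →L[ℝ] ℝ) : V →ₗ[ℝ] V →L[ℝ] ℝ) := by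
      refine v.ext fun i => ?_
      apply ContinuousLinearMap.coe_injective
      refine v.ext fun j => ?_
      by_cases hij : i = j
      · subst hij; simp [hdiag]
      · simp [off i j hij, h1 i j hij]
    have := congrArg (fun L => L x y) this
    simpa using this
  · have := dg i₀ j hj.symm
    rw [hdiag i₀, hdiag j] at this
    apply mul_right_cancel₀ (mul_ne_zero (h2 i₀) (h2 j))
    linear_combination this

end AlgebraicGauss

/-! ### Pseudo-Euclidean inner product, isometries and normal vectors -/

section PseudoEuclidean

/-- The inner product of the pseudo-Euclidean space as a continuous bilinear map. -/
noncomputable def pseudoInnerL (m s : ℕ) : (Fin m → ℝ) →L[ℝ] (Fin m → ℝ) →L[ℝ] ℝ :=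
  ∑ i : Fin m, (if (i : ℕ) + s < m then (1 : ℝ) else -1) •
    (ContinuousLinearMap.proj (R := ℝ) (φ := fun _ : Fin m => ℝ) i).smulRight
      (ContinuousLinearMap.proj (R := ℝ) (φ := fun _ : Fin m => ℝ) i)

theorem pseudoInnerL_apply {m : ℕ} (s : ℕ) (x y : Fin m → ℝ) :
    pseudoInnerL m s x y = pseudoInner s x y := by
  rw [pseudoInnerL, pseudoInner, sum_apply, sum_apply]
  refine Finset.sum_congr rfl fun i _ => ?_
  simp only [smul_apply, smul_eq_mul]
  rfl

theorem pseudoInnerL_symm {m : ℕ} (s : ℕ) (x y : Fin m → ℝ) :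
    pseudoInnerL m s x y = pseudoInnerL m s y x := by
  simp only [pseudoInnerL_apply, pseudoInner, mul_comm (x _)]

theorem pseudoInnerL_nondegenerate {m : ℕ} (s : ℕ) (x : Fin m → ℝ)
    (h : ∀ y, pseudoInnerL m s x y = 0) : x = 0 := by
  ext i
  have := h (Pi.single i 1)
  rw [pseudoInnerL_apply, pseudoInner, Finset.sum_eq_single i] at this
  · simp only [Pi.single_eq_same, mul_one] at this
    rcases mul_eq_zero.1 this with h0 | h0
    · split_ifs at h0 <;> norm_num at h0
    · exact h0
  · intro j _ hj
    simp [hj]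
  · simp

end PseudoEuclidean

section Bilinear

variable {W : Type*} [NormedAddCommGroup W] [NormedSpace ℝ W] {B : W →L[ℝ] W →L[ℝ] ℝ}

theorem exists_reflection (hB : ∀ x y, B x y = B y x) {v : W} (hv : B v v ≠ 0) :
    ∃ A : W ≃ₗ[ℝ] W, (∀ x y, B (A x) (A y) = B x y) ∧
      ∀ x, A x = x - (2 * B x v / B v v) • v := by
  let R : W →ₗ[ℝ] W := LinearMap.id - (2 / B v v) • ((B.flip v).toLinearMap.smulRight v)
  have hR : ∀ x, R x = x - (2 * B x v / B v v) • v := by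
    intro x
    simp only [R, LinearMap.sub_apply, LinearMap.id_apply, LinearMap.smul_apply,
      LinearMap.smulRight_apply, ContinuousLinearMap.coe_coe, ContinuousLinearMap.flip_apply,
      smul_smul]
    congr 2
    ring
  have hi : Function.Involutive R := by
    intro x
    rw [hR (R x), hR x]
    simp only [map_sub, map_smul, sub_apply, smul_apply, smul_eq_mul]
    rw [sub_sub, ← add_smul]
    have : 2 * B x v / B v v + 2 * (B x v - 2 * B x v / B v v * B v v) / B v v = 0 := by
      field_simp; ring
    rw [this, zero_smul, sub_zero]
  refine ⟨LinearEquiv.ofInvolutive R hi, fun x y => ?_, fun x => hR x⟩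
  simp only [LinearEquiv.coe_ofInvolutive, hR, map_sub, map_smul, sub_apply, smul_apply,
    smul_eq_mul]
  rw [hB v y]
  field_simp
  ring

/-- Since the squares of `x - y` and `x + y` add up to `4 B x x ≠ 0`, one of them is not null.
Reflection in `x - y` sends `x` to `y`; otherwise reflection in `x + y` sends `x` to `-y`, and
reflection in `y` corrects the sign. All these reflections fix what is orthogonal to both `x` and
`y`. -/
theorem exists_isometry_apply_eq (hB : ∀ x y, B x y = B y x) {x y : W} (hx : B x x ≠ 0)
    (hxy : B x x = B y y) :
    ∃ A : W ≃ₗ[ℝ] W, (∀ u v, B (A u) (A v) = B u v) ∧ A x = y ∧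
      ∀ z, B z x = 0 → B z y = 0 → A z = z := by
  by_cases h : B (x - y) (x - y) = 0
  · have h' : B (x + y) (x + y) ≠ 0 := by
      simp only [map_sub, map_add, sub_apply, add_apply] at h ⊢
      intro h2
      apply hx
      linarith
    obtain ⟨A, hA, hA'⟩ := exists_reflection hB h'
    obtain ⟨A₂, hA₂, hA₂'⟩ := exists_reflection hB (v := y) (hxy ▸ hx)
    have hxs : A x = -y := by
      have : 2 * B x (x + y) / B (x + y) (x + y) = 1 := by
        rw [div_eq_one_iff_eq h']
        simp only [map_add, add_apply]
        rw [hB y x, ← hxy]; ring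
      rw [hA', this]; simp
    refine ⟨A.trans A₂, fun u v => ?_, ?_, fun z h1 h2 => ?_⟩
    · simp [hA, hA₂]
    · simp only [LinearEquiv.trans_apply, hxs, map_neg, hA₂']
      simp only [neg_apply, mul_div_assoc, neg_div, div_self (hxy ▸ hx : B y y ≠ 0)]
      rw [mul_neg, mul_one, neg_smul, two_smul]; abel
    · simp [hA', hA₂', h1, h2]
  · obtain ⟨A, hA, hA'⟩ := exists_reflection hB h
    refine ⟨A, hA, ?_, fun z h1 h2 => ?_⟩
    · have : 2 * B x (x - y) / B (x - y) (x - y) = 1 := by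
        rw [div_eq_one_iff_eq h]
        simp only [map_sub, sub_apply]
        rw [hB y x, ← hxy]; ring
      rw [hA', this]; simp
    · simp [hA', h1, h2]

/-- Witt's theorem for pairs of orthogonal anisotropic vectors. -/
theorem exists_isometry_apply_eq_pair (hB : ∀ x y, B x y = B y x) {x₁ x₂ y₁ y₂ : W}
    (h1 : B x₁ x₁ ≠ 0) (h2 : B x₂ x₂ ≠ 0) (hx : B x₁ x₂ = 0) (hy : B y₁ y₂ = 0)
    (e1 : B x₁ x₁ = B y₁ y₁) (e2 : B x₂ x₂ = B y₂ y₂) :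
    ∃ A : W ≃ₗ[ℝ] W, (∀ u v, B (A u) (A v) = B u v) ∧ A x₁ = y₁ ∧ A x₂ = y₂ := by
  obtain ⟨A, hA, hA', -⟩ := exists_isometry_apply_eq hB h1 e1
  have h2' : B (A x₂) (A x₂) ≠ 0 := by rwa [hA]
  obtain ⟨A₂, hA₂, hA₂', hz⟩ := exists_isometry_apply_eq hB h2' (y := y₂) (by rw [hA, e2])
  refine ⟨A.trans A₂, fun u v => ?_, ?_, ?_⟩
  · simp [hA, hA₂]
  · simp only [LinearEquiv.trans_apply, hA']
    exact hz _ (by rw [← hA', hA, hx]) hy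
  · simp [hA₂']

variable {V : Type*} [NormedAddCommGroup V] [NormedSpace ℝ V] [FiniteDimensional ℝ V]
  [FiniteDimensional ℝ W]

/-- The orthogonal complement of a nondegenerate hyperplane is a line. -/
theorem eq_zero_of_orthogonal_range
    (hBn : ∀ x, (∀ y, B x y = 0) → x = 0)
    {D : V →L[ℝ] W} (hdim : Module.finrank ℝ V + 1 = Module.finrank ℝ W)
    (hD : ∀ u, (∀ v, B (D u) (D v) = 0) → u = 0) {ξ ν : W} (hξ : ξ ≠ 0)
    (hξD : ∀ u, B ξ (D u) = 0) (hνD : ∀ u, B ν (D u) = 0) (hν : B ν ξ = 0) : ν = 0 := by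
  let Φ : (V × ℝ) →ₗ[ℝ] W :=
    (D : V →ₗ[ℝ] W).coprod (LinearMap.toSpanSingleton ℝ W ξ)
  have hΦ : ∀ p, Φ p = D p.1 + p.2 • ξ := fun p => by simp [Φ]
  have hinj : Function.Injective Φ := by
    rw [← LinearMap.ker_eq_bot, LinearMap.ker_eq_bot']
    rintro ⟨u, r⟩ h
    rw [hΦ] at h
    have hu : u = 0 := by
      refine hD u fun v => ?_
      have := congrArg (fun w => B w (D v)) h
      simpa [hξD] using this
    subst hu
    simpa [hξ] using h
  have hsurj : Function.Surjective Φ := by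
    refine (LinearMap.injective_iff_surjective_of_finrank_eq_finrank ?_).1 hinj
    simpa using hdim
  refine hBn ν fun y => ?_
  obtain ⟨p, rfl⟩ := hsurj y
  simp [hΦ, hνD, hν]

/-- A dimension count yields a nonzero normal. If it were null, it would be orthogonal to itself as
well as to the hyperplane, hence zero. -/
theorem exists_normal
    (hBn : ∀ x, (∀ y, B x y = 0) → x = 0)
    {D : V →L[ℝ] W} (hdim : Module.finrank ℝ V + 1 = Module.finrank ℝ W)
    (hD : ∀ u, (∀ v, B (D u) (D v) = 0) → u = 0) :
    ∃ ξ, (∀ u, B ξ (D u) = 0) ∧ B ξ ξ ≠ 0 := by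
  let Ψ : W →ₗ[ℝ] Module.Dual ℝ V := LinearMap.mk₂ ℝ (fun w v => B w (D v))
    (by simp) (by simp) (by simp) (by simp)
  have : ¬ Function.Injective Ψ := by
    intro h
    have := LinearMap.finrank_le_finrank_of_injective h
    rw [Subspace.dual_finrank_eq] at this
    omega
  rw [← LinearMap.ker_eq_bot, LinearMap.ker_eq_bot'] at this
  push Not at this
  obtain ⟨ξ, h1, h2⟩ := this
  have h3 : ∀ u, B ξ (D u) = 0 := fun u => congrArg (fun L => L u) h1
  exact ⟨ξ, h3, fun h => h2 (eq_zero_of_orthogonal_range hBn hdim hD h2 h3 h3 h)⟩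

end Bilinear

/-! ### The second fundamental form of a warped product hypersurface -/

section LocalWarpedImmersion

variable {E W : Type*} [NormedAddCommGroup E] [NormedSpace ℝ E] [FiniteDimensional ℝ E]
  [NormedAddCommGroup W] [NormedSpace ℝ W] [FiniteDimensional ℝ W]

omit [FiniteDimensional ℝ E] in
theorem christoffel_zero_left (G : E → E →L[ℝ] E →L[ℝ] ℝ) (y v : E) :
    christoffel G y 0 v = 0 := by
  simp [christoffel]

/-- Pointwise consequences of the Gauss equation for an isometric immersion, as a hypersurface of
a pseudo-Euclidean space, of a warped product over a fibre of constant curvature `c`. -/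
theorem warped_hypersurface_second_derivative {B : W →L[ℝ] W →L[ℝ] ℝ}
    (hB : ∀ x y, B x y = B y x) (hBn : ∀ x, (∀ y, B x y = 0) → x = 0)
    (hdim : Module.finrank ℝ E + 2 = Module.finrank ℝ W) (hE : 2 ≤ Module.finrank ℝ E)
    {η c : ℝ} (hη : η ^ 2 = 1) {f : ℝ → ℝ} {k : E → E →L[ℝ] E →L[ℝ] ℝ} {z : ℝ × E}
    {φ : ℝ × E → W} (hφ : ContDiffAt ℝ ∞ φ z)
    (hG : ∀ᶠ x in 𝓝 z, ∀ a b, warpedForm η f k x a b = B (fderiv ℝ φ x a) (fderiv ℝ φ x b))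
    (hf : ContDiffAt ℝ ∞ f z.1) (hfz : f z.1 ≠ 0) (hk : ContDiffAt ℝ ∞ k z.2)
    (hkz : ∀ u, (∀ v, k z.2 u v = 0) → u = 0) (hs : ∀ᶠ y in 𝓝 z.2, ∀ a b, k y a b = k y b a)
    (hc : ∀ u v, k z.2 (riemannCurvature k z.2 u v v) u
      = c * (k z.2 u u * k z.2 v v - k z.2 u v ^ 2))
    (hU : deriv (deriv f) z.1 ≠ 0 ∨ c - η * deriv f z.1 ^ 2 ≠ 0) :
    (∀ X, fderiv ℝ (fderiv ℝ φ) z (1, 0) (0, X)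
      = (deriv f z.1 / f z.1) • fderiv ℝ φ z (0, X)) ∧
    (deriv (deriv f) z.1 ≠ 0 ∨ 3 ≤ Module.finrank ℝ E → c - η * deriv f z.1 ^ 2 ≠ 0 ∧
      ∃ Z, (∀ w, B Z (fderiv ℝ φ z w) = 0) ∧ B Z Z = f z.1 ^ 2 * (c - η * deriv f z.1 ^ 2) ∧
        ∀ X Y, fderiv ℝ (fderiv ℝ φ) z (0, X) (0, Y)
          = k z.2 X Y • Z + fderiv ℝ φ z (christoffel (warpedForm η f k) z (0, X) (0, Y))) := by
  have hη0 : η ≠ 0 := by rintro rfl; norm_num at hη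
  have hnd := warpedForm_nondegenerate hη0 hfz hkz
  have hi := isInvertible_of_nondegenerate hnd
  have hD : ∀ u, (∀ v, B (fderiv ℝ φ z u) (fderiv ℝ φ z v) = 0) → u = 0 := fun u hu =>
    hnd u fun v => by rw [hG.self_of_nhds, hu]
  have hdim' : Module.finrank ℝ (ℝ × E) + 1 = Module.finrank ℝ W := by
    rw [Module.finrank_prod, Module.finrank_self, ← hdim]; ring
  obtain ⟨ξ, hξ, hξξ⟩ := exists_normal hBn hdim' hD
  have hξ0 : ξ ≠ 0 := by rintro rfl; simp at hξξ
  set e := B ξ ξ with he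
  -- The scalar second fundamental form. The factor `e⁻¹` is there because `ξ` is not normalized,
  -- and the tangential correction is invisible to `ξ`.
  let β : (ℝ × E) →L[ℝ] (ℝ × E) →L[ℝ] ℝ :=
    e⁻¹ • ((ContinuousLinearMap.compL ℝ (ℝ × E) W ℝ (B.flip ξ)).comp (fderiv ℝ (fderiv ℝ φ) z))
  have hβ : ∀ u v, β u v = e⁻¹ * B (fderiv ℝ (fderiv ℝ φ) z u v) ξ := fun u v => by simp [β]
  let σ : ℝ × E → ℝ × E → W := fun u v => fderiv ℝ (fderiv ℝ φ) z u v
    - fderiv ℝ φ z (christoffel (warpedForm η f k) z u v)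
  have hσ : ∀ u v, σ u v = β u v • ξ := by
    intro u v
    rw [← sub_eq_zero]
    refine eq_zero_of_orthogonal_range hBn hdim' hD hξ0 hξ (fun w => ?_) ?_
    · rw [map_sub, sub_apply, apply_fderiv_fderiv_eq hB hφ hG hi, map_smul, smul_apply, hξ]
      simp
    · simp only [σ, map_sub, sub_apply, map_smul, smul_apply, smul_eq_mul, hβ]
      rw [hB (fderiv ℝ φ z _) ξ, hξ, ← he]
      field_simp
      ring
  have hsym := hφ.isSymmSndFDerivAt minSmoothness_two_le_infty
  have hβs : ∀ u v, β u v = β v u := fun u v => by rw [hβ, hβ, hsym.eq u v]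
  have gauss : ∀ u v, e * (β u u * β v v - β u v ^ 2)
      = -(f z.1 * deriv (deriv f) z.1) * k z.2 (u.1 • v.2 - v.1 • u.2) (u.1 • v.2 - v.1 • u.2)
        + f z.1 ^ 2 * (c - η * deriv f z.1 ^ 2)
          * (k z.2 u.2 u.2 * k z.2 v.2 v.2 - k z.2 u.2 v.2 ^ 2) := by
    intro u v
    have h1 := gauss_equation hB hφ hG hi (σ := σ) (fun _ _ => rfl) u v
    rw [apply_riemannCurvature_warpedForm hη hf hk hfz hkz hs, hc] at h1
    simp only [hσ, map_smul, smul_apply, smul_eq_mul, ← he] at h1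
    linear_combination -h1
  let l : E →L[ℝ] ℝ := (β (1, 0)).comp (ContinuousLinearMap.inr ℝ ℝ E)
  let h : E →L[ℝ] E →L[ℝ] ℝ := pullbackForm β (ContinuousLinearMap.inr ℝ ℝ E)
  have hl : ∀ X, l X = β (1, 0) (0, X) := fun X => by simp [l]
  have hh : ∀ X Y, h X Y = β (0, X) (0, Y) := fun X Y => by simp [h, pullbackForm]
  have H1 : ∀ Y, e * (β (1, 0) (1, 0) * h Y Y - l Y ^ 2)
      = -(f z.1 * deriv (deriv f) z.1) * k z.2 Y Y := by
    intro Y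
    rw [hh, hl, gauss]
    simp
  have H2 : ∀ X Y, e * (h X X * h Y Y - h X Y ^ 2)
      = f z.1 ^ 2 * (c - η * deriv f z.1 ^ 2) * (k z.2 X X * k z.2 Y Y - k z.2 X Y ^ 2) := by
    intro X Y
    rw [hh, hh, hh, gauss]
    simp
  have H3 : ∀ X Y, l X * h Y Y = l Y * h X Y := by
    intro X Y
    -- Gauss on the plane spanned by `∂_t + X` and `Y`: subtracting the equations for `(∂_t, Y)` and
    -- `(X, Y)` leaves a cross term on the left and nothing on the right.
    have := gauss ((1, 0) + (0, X)) (0, Y)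
    simp only [map_add, add_apply, ← hh, ← hl, hβs (0, X) (1, 0)] at this
    simp at this
    have h1 := H1 Y
    have h2 := H2 X Y
    have : 2 * e * (l X * h Y Y - l Y * h X Y) = 0 := by linear_combination this - h1 - h2
    have := (mul_eq_zero.1 this).resolve_left (mul_ne_zero two_ne_zero hξξ)
    linarith
  have hks := hs.self_of_nhds
  have hhs : ∀ x y, h x y = h y x := fun x y => by rw [hh, hh, hβs]
  have hl0 := mixed_part_eq_zero hks hkz hE hhs H1 H2 H3 (by
    refine hU.imp (fun h => neg_ne_zero.2 (mul_ne_zero hfz h))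
      fun h => mul_ne_zero (pow_ne_zero 2 hfz) h)
  refine ⟨fun X => ?_, fun hd => ?_⟩
  · have h1 := hσ (1, 0) (0, X)
    rw [← hl, hl0, zero_smul] at h1
    rw [sub_eq_zero.1 h1, christoffel_warpedForm hη (hf.differentiableAt (by simp))
      (hk.differentiableAt (by simp)) hfz hkz]
    simp only [map_zero, zero_apply, mul_zero, neg_zero, christoffel_zero_left, one_smul, smul_zero,
      zero_add, add_zero]
    rw [← map_smul]
    simp
  · have H1' : ∀ Y, e * (β (1, 0) (1, 0) * h Y Y)
        = -(f z.1 * deriv (deriv f) z.1) * k z.2 Y Y := by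
      intro Y
      rw [← H1, hl0]; ring
    have main : f z.1 ^ 2 * (c - η * deriv f z.1 ^ 2) ≠ 0 ∧ ∃ r, (∀ x y, h x y = r * k z.2 x y) ∧
        e * r ^ 2 = f z.1 ^ 2 * (c - η * deriv f z.1 ^ 2) := by
      by_cases h0 : deriv (deriv f) z.1 = 0
      · have h3 := hd.resolve_left (not_not.2 h0)
        have hK := mul_ne_zero (pow_ne_zero 2 hfz) (hU.resolve_left (not_not.2 h0))
        exact ⟨hK, umbilic_of_three_le hks hkz h3 hhs hξξ H2 hK⟩
      · exact umbilic_of_mixed_ne_zero hks hkz hE hhs hξξ H1' H2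
          (neg_ne_zero.2 (mul_ne_zero hfz h0))
    obtain ⟨hK, r, hr, her⟩ := main
    -- Rescaling `ξ` rescales `r` inversely, so `r ξ` does not depend on the chosen normal and no
    -- orientation is needed.
    refine ⟨right_ne_zero_of_mul hK, r • ξ, fun w => by simp [hξ], ?_, fun X Y => ?_⟩
    · rw [← her]; simp [← he]; ring
    · rw [← sub_eq_iff_eq_add, smul_smul, mul_comm, ← hr, hh]
      exact hσ _ _

end LocalWarpedImmersion

/-! ### Passing between preferred charts -/

section Charts

variable {E : Type*} [NormedAddCommGroup E] [NormedSpace ℝ E]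
  {H : Type*} [TopologicalSpace H] {I : ModelWithCorners ℝ E H}
  {N : Type*} [TopologicalSpace N] [ChartedSpace H N]

theorem eventually_chart_transition {x q : N} {y : E} (hy : y ∈ (extChartAt I x).target)
    (hq : (extChartAt I x).symm y = q) :
    ∀ᶠ w in 𝓝 y, (extChartAt I q).symm (extChartAt I q ((extChartAt I x).symm w))
      = (extChartAt I x).symm w := by
  have h1 : ContinuousAt (extChartAt I x).symm y := continuousAt_extChartAt_symm'' hy
  have h2 : (extChartAt I q).source ∈ 𝓝 ((extChartAt I x).symm y) := by
    rw [hq]; exact extChartAt_source_mem_nhds q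
  filter_upwards [h1 h2] with w hw using (extChartAt I q).left_inv hw

variable [I.Boundaryless]

theorem chart_transition_self (x : N) :
    (fun w => extChartAt I x ((extChartAt I x).symm w)) =ᶠ[𝓝 (extChartAt I x x)] id := by
  filter_upwards [extChartAt_target_mem_nhds x] with w hw using (extChartAt I x).right_inv hw

variable [IsManifold I ∞ N]

theorem contDiffAt_chart_transition {x q : N} {y : E} (hy : y ∈ (extChartAt I x).target)
    (hq : (extChartAt I x).symm y = q) :
    ContDiffAt ℝ ∞ (fun w => extChartAt I q ((extChartAt I x).symm w)) y := by
  rw [← contMDiffAt_iff_contDiffAt]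
  have h1 : ContMDiffAt 𝓘(ℝ, E) I ∞ (extChartAt I x).symm y :=
    (contMDiffOn_extChartAt_symm x).contMDiffAt ((isOpen_extChartAt_target x).mem_nhds hy)
  have h2 : ContMDiffAt I 𝓘(ℝ, E) ∞ (extChartAt I q) ((extChartAt I x).symm y) := by
    rw [hq]; exact contMDiffAt_extChartAt
  exact h2.comp y h1

/-- The tangent space at `q` is identified with `E` by the preferred chart at `q`, so the
differential of another inverse chart is that of a transition map. -/
theorem mfderiv_chart_symm {x q : N} {y : E} (hy : y ∈ (extChartAt I x).target)
    (hq : (extChartAt I x).symm y = q) (u : E) :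
    (mfderiv 𝓘(ℝ, E) I (extChartAt I x).symm y u : E)
      = fderiv ℝ (fun w => extChartAt I q ((extChartAt I x).symm w)) y u := by
  subst hq
  have h1 : MDifferentiableAt 𝓘(ℝ, E) I (extChartAt I x).symm y :=
    ((contMDiffOn_extChartAt_symm (n := ∞) x).contMDiffAt
      ((isOpen_extChartAt_target x).mem_nhds hy)).mdifferentiableAt (by simp)
  refine (congrArg (fun L : E →L[ℝ] E => L u) h1.mfderiv).trans ?_
  simp only [ModelWithCorners.range_eq_univ, fderivWithin_univ]
  rfl

theorem chartMetric_apply (g : ∀ x : N, TangentSpace I x →L[ℝ] TangentSpace I x →L[ℝ] ℝ)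
    {x q : N} {y : E} (hy : y ∈ (extChartAt I x).target)
    (hq : (extChartAt I x).symm y = q) (u v : E) :
    chartMetric I g x y u v
      = g q (fderiv ℝ (fun w => extChartAt I q ((extChartAt I x).symm w)) y u)
        (fderiv ℝ (fun w => extChartAt I q ((extChartAt I x).symm w)) y v) := by
  rw [← mfderiv_chart_symm hy hq, ← mfderiv_chart_symm hy hq]
  subst hq
  rfl

theorem chartMetric_self (g : ∀ x : N, TangentSpace I x →L[ℝ] TangentSpace I x →L[ℝ] ℝ)
    (x : N) (u v : E) : chartMetric I g x (extChartAt I x x) u v = g x u v := by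
  rw [chartMetric_apply g (mem_extChartAt_target x) (extChartAt_to_inv x),
    (chart_transition_self x).fderiv_eq]
  simp

theorem fderiv_chart_transition_surjective [FiniteDimensional ℝ E] {x q : N} {y : E}
    (hy : y ∈ (extChartAt I x).target) (hq : (extChartAt I x).symm y = q) :
    Function.Surjective
      (fderiv ℝ (fun w => extChartAt I q ((extChartAt I x).symm w)) y) := by
  have h1 := isInvertible_mfderivWithin_extChartAt_symm (I := I) hy
  rw [I.range_eq_univ, mfderivWithin_univ] at h1
  intro v
  obtain ⟨A, hA⟩ := h1
  refine ⟨A.symm v, ?_⟩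
  refine (mfderiv_chart_symm hy hq (A.symm v)).symm.trans ?_
  refine Eq.trans ?_ (A.apply_symm_apply v)
  exact (congrArg (fun L : E →L[ℝ] E => L (A.symm v)) hA).symm

/-- A map whose derivative vanishes at the centre of every preferred chart is constant. -/
theorem eq_of_hasFDerivAt_zero [ConnectedSpace N] {V : Type*} [NormedAddCommGroup V]
    [NormedSpace ℝ V] {ζ : N → V}
    (h : ∀ q : N, HasFDerivAt (fun w => ζ ((extChartAt I q).symm w)) (0 : E →L[ℝ] V)
      (extChartAt I q q)) (p q : N) : ζ p = ζ q := by
  have hloc : IsLocallyConstant ζ := by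
    rw [IsLocallyConstant.iff_eventually_eq]
    intro x
    obtain ⟨r, hr, hball⟩ := Metric.isOpen_iff.1 (isOpen_extChartAt_target (I := I) x) _
      (mem_extChartAt_target x)
    -- At a point other than the centre, compose with the transition to the chart centred there,
    -- where the hypothesis applies.
    have hd : ∀ y ∈ (extChartAt I x).target,
        HasFDerivAt (fun w => ζ ((extChartAt I x).symm w)) (0 : E →L[ℝ] V) y := by
      intro y hy
      have h1 := (contDiffAt_chart_transition (I := I) hy rfl).differentiableAt (by simp)
      have h2 := (h ((extChartAt I x).symm y)).comp y h1.hasFDerivAt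
      rw [ContinuousLinearMap.zero_comp] at h2
      refine h2.congr_of_eventuallyEq ?_
      filter_upwards [eventually_chart_transition (I := I) hy rfl] with w hw
      exact congrArg ζ hw.symm
    have hconst : ∀ y ∈ Metric.ball (extChartAt I x x) r,
        ζ ((extChartAt I x).symm y) = ζ ((extChartAt I x).symm (extChartAt I x x)) := by
      intro y hy
      refine (convex_ball (extChartAt I x x) r).is_const_of_fderivWithin_eq_zero
        (𝕜 := ℝ) (f := fun w => ζ ((extChartAt I x).symm w))
        (fun z hz => (hd z (hball hz)).differentiableAt.differentiableWithinAt)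
        (fun z hz => ?_) hy (Metric.mem_ball_self hr)
      rw [fderivWithin_of_isOpen Metric.isOpen_ball hz, (hd z (hball hz)).fderiv]
    have hn : ∀ᶠ q in 𝓝 x, extChartAt I x q ∈ Metric.ball (extChartAt I x x) r :=
      (continuousAt_extChartAt x).eventually (Metric.ball_mem_nhds _ hr)
    filter_upwards [hn, extChartAt_source_mem_nhds (I := I) x] with q hq hq'
    have := hconst _ hq
    rwa [(extChartAt I x).left_inv hq', extChartAt_to_inv] at this
  exact hloc.apply_eq_of_preconnectedSpace p q

end Charts

/-! ### Sectional curvature of the warped product manifold -/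

section WarpedManifold

variable {E : Type*} [NormedAddCommGroup E] [NormedSpace ℝ E]
  {H : Type*} [TopologicalSpace H] {I : ModelWithCorners ℝ E H} [I.Boundaryless]
  {N : Type*} [TopologicalSpace N] [ChartedSpace H N] [IsManifold I ∞ N]
  {g : ∀ x : N, TangentSpace I x →L[ℝ] TangentSpace I x →L[ℝ] ℝ} {η c : ℝ} {f : ℝ → ℝ}

omit [I.Boundaryless] [IsManifold I ∞ N] in
theorem extChartAt_prod_apply (t : ℝ) (q : N) (p : ℝ × N) :
    extChartAt (𝓘(ℝ, ℝ).prod I) ((t, q) : ℝ × N) p = (p.1, extChartAt I q p.2) := by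
  rw [extChartAt_prod]
  simp only [mfld_simps]
  rfl

omit [I.Boundaryless] [IsManifold I ∞ N] in
theorem extChartAt_prod_symm_apply (t : ℝ) (q : N) (z : ℝ × E) :
    (extChartAt (𝓘(ℝ, ℝ).prod I) ((t, q) : ℝ × N)).symm z = (z.1, (extChartAt I q).symm z.2) := by
  rw [extChartAt_prod]
  simp only [mfld_simps]
  rfl

omit [I.Boundaryless] [IsManifold I ∞ N] in
theorem mem_extChartAt_prod_target {t s : ℝ} {q : N} {y : E} (hy : y ∈ (extChartAt I q).target) :
    (s, y) ∈ (extChartAt (𝓘(ℝ, ℝ).prod I) ((t, q) : ℝ × N)).target := by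
  rw [extChartAt_prod]
  exact ⟨by simp only [extChartAt_model_space_eq_id]; exact mem_univ s, hy⟩

/-- The change from the chart at `q` to the chart at `q'`, times the identity of the line. -/
noncomputable def productTransition (I : ModelWithCorners ℝ E H) (q q' : N) (z : ℝ × E) : ℝ × E :=
  (z.1, extChartAt I q' ((extChartAt I q).symm z.2))

theorem contDiffAt_productTransition {q q' : N} {z : ℝ × E} (hy : z.2 ∈ (extChartAt I q).target)
    (hq : (extChartAt I q).symm z.2 = q') :
    ContDiffAt ℝ ∞ (productTransition I q q') z :=
  contDiffAt_fst.prodMk ((contDiffAt_chart_transition hy hq).comp z contDiffAt_snd)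

theorem fderiv_productTransition {q q' : N} {z : ℝ × E} (hy : z.2 ∈ (extChartAt I q).target)
    (hq : (extChartAt I q).symm z.2 = q') (u : ℝ × E) :
    fderiv ℝ (productTransition I q q') z u
      = (u.1, fderiv ℝ (fun w => extChartAt I q' ((extChartAt I q).symm w)) z.2 u.2) := by
  have h : HasFDerivAt (productTransition I q q') _ z :=
    (hasFDerivAt_fst (𝕜 := ℝ) (p := z)).prodMk
    (((contDiffAt_chart_transition (I := I) hy hq).differentiableAt
      (by simp)).hasFDerivAt.comp z hasFDerivAt_snd)
  rw [h.fderiv]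
  rfl

theorem chartMetric_warpedMetric {t s : ℝ} {q : N} {y : E} (hy : y ∈ (extChartAt I q).target) :
    chartMetric (𝓘(ℝ, ℝ).prod I) (warpedMetric I η f g) (t, q) (s, y)
      = warpedForm η f (chartMetric I g q) (s, y) := by
  set q' := (extChartAt I q).symm y with hq
  have hΘ : (fun w => extChartAt (𝓘(ℝ, ℝ).prod I) ((s, q') : ℝ × N)
      ((extChartAt (𝓘(ℝ, ℝ).prod I) ((t, q) : ℝ × N)).symm w)) = productTransition I q q' := by
    ext1 w
    rw [extChartAt_prod_apply, extChartAt_prod_symm_apply]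
    rfl
  refine ContinuousLinearMap.ext fun u => ContinuousLinearMap.ext fun v => ?_
  refine (chartMetric_apply (I := 𝓘(ℝ, ℝ).prod I) (warpedMetric I η f g)
    (mem_extChartAt_prod_target hy) (extChartAt_prod_symm_apply t q (s, y)) u v).trans ?_
  rw [hΘ]
  have h1 := fderiv_productTransition (I := I) (z := (s, y)) hy rfl u
  have h2 := fderiv_productTransition (I := I) (z := (s, y)) hy rfl v
  refine (congrArg₂ (fun a b : ℝ × E => (warpedMetric I η f g (s, q') a b : ℝ)) h1 h2).trans ?_
  rw [warpedForm_apply, chartMetric_apply g hy rfl]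
  rfl

/-- Only the germ of the coordinate metric matters; the right side is free of divisions and
tangent-space casts. -/
theorem hasSectionalCurvatureAt_iff {x : N} {y : E} (hy : extChartAt I x x = y)
    {k : E → E →L[ℝ] E →L[ℝ] ℝ} (hk : chartMetric I g x =ᶠ[𝓝 y] k) (K : ℝ) :
    HasSectionalCurvatureAt I g x K ↔ ∀ u v : E,
      k y u u * k y v v - k y u v ^ 2 ≠ 0 →
      k y (riemannCurvature k y u v v) u = K * (k y u u * k y v v - k y u v ^ 2) := by
  subst hy
  set y := extChartAt I x x
  have h1 : ∀ u v : E, g x u v = k y u v := fun u v => by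
    rw [← hk.eq_of_nhds, chartMetric_self]
  refine forall_congr' fun (u : E) => forall_congr' fun (v : E) => ?_
  have h2 : g x u u * g x v v - g x u v ^ 2 = k y u u * k y v v - k y u v ^ 2 :=
    congrArg₂ (· - ·) (congrArg₂ (· * ·) (h1 u u) (h1 v v)) (congrArg (· ^ 2) (h1 u v))
  have h3 : sectionalCurvature I g x u v
      = k y (riemannCurvature k y u v v) u / (k y u u * k y v v - k y u v ^ 2) :=
    congrArg₂ (· / ·) ((h1 _ _).trans (by rw [riemannCurvature_congr hk])) h2
  refine Iff.trans (imp_congr (not_congr (Eq.congr_left h2)) (Eq.congr_left h3)) ?_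
  exact imp_congr_right fun h => div_eq_iff h

omit [I.Boundaryless] [IsManifold I ∞ N] in
theorem chartMetric_symm (hg : IsPseudoRiemannianMetric I g) (q : N) (y a b : E) :
    chartMetric I g q y a b = chartMetric I g q y b a :=
  hg.symm _ _ _

theorem chartMetric_nondegenerate [FiniteDimensional ℝ E] (hg : IsPseudoRiemannianMetric I g)
    {q : N} {y : E} (hy : y ∈ (extChartAt I q).target) (u : E)
    (h : ∀ v, chartMetric I g q y u v = 0) : u = 0 := by
  have hs := fderiv_chart_transition_surjective (I := I) hy rfl
  have hi : Function.Injective (fderiv ℝ (fun w => extChartAt I ((extChartAt I q).symm y)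
      ((extChartAt I q).symm w)) y) :=
    (LinearMap.injective_iff_surjective (f := (fderiv ℝ (fun w => extChartAt I
      ((extChartAt I q).symm y) ((extChartAt I q).symm w)) y).toLinearMap)).2 hs
  refine (map_eq_zero_iff _ hi).1 (hg.nondegenerate ((extChartAt I q).symm y) _ fun v => ?_)
  obtain ⟨v', hv'⟩ := hs v
  rw [← hv']
  exact (chartMetric_apply g hy rfl u v').symm.trans (h v')

omit [IsManifold I ∞ N] in
theorem contDiffAt_chartMetric (hg : IsPseudoRiemannianMetric I g) {q : N} {y : E}
    (hy : y ∈ (extChartAt I q).target) : ContDiffAt ℝ ∞ (chartMetric I g q) y :=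
  (hg.smooth q).contDiffAt ((isOpen_extChartAt_target q).mem_nhds hy)

variable [FiniteDimensional ℝ E]

theorem riemannCurvature_chartMetric (hE : 2 ≤ Module.finrank ℝ E)
    (hg : IsPseudoRiemannianMetric I g) {q : N} (hc : HasSectionalCurvatureAt I g q c) (u v : E) :
    chartMetric I g q (extChartAt I q q)
        (riemannCurvature (chartMetric I g q) (extChartAt I q q) u v v) u
      = c * (chartMetric I g q (extChartAt I q q) u u * chartMetric I g q (extChartAt I q q) v v
        - chartMetric I g q (extChartAt I q q) u v ^ 2) := by
  obtain ⟨x, y, hx, hy, hxy⟩ := exists_nondegenerate_plane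
    (G := chartMetric I g q (extChartAt I q q))
    (chartMetric_symm hg q _) (chartMetric_nondegenerate hg (mem_extChartAt_target q)) hE
  refine apply_riemannCurvature_eq_of_forall_nondegenerate (u₀ := x) (v₀ := y)
    (contDiffAt_chartMetric hg (mem_extChartAt_target q))
    (isInvertible_of_nondegenerate (chartMetric_nondegenerate hg (mem_extChartAt_target q)))
    (Filter.Eventually.of_forall (chartMetric_symm hg q)) ?_ (fun u v h => ?_) u v
  · rw [hxy]; simpa using ⟨hx, hy⟩
  · exact (hasSectionalCurvatureAt_iff rfl Filter.EventuallyEq.rfl c).1 hc u v h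

/-- Numerator and denominator are combinations of the same two quadratic expressions in `u ∧ v`, so
the quotient is constant iff the coefficients are proportional. -/
theorem sectionalCurvature_warpedMetric (hE : 2 ≤ Module.finrank ℝ E)
    (hg : IsPseudoRiemannianMetric I g) (hη : η ^ 2 = 1) {t : ℝ} {q : N}
    (hc : HasSectionalCurvatureAt I g q c) (hf : ContDiffAt ℝ ∞ f t) (hft : f t ≠ 0)
    (K : ℝ) :
    HasSectionalCurvatureAt (𝓘(ℝ, ℝ).prod I) (warpedMetric I η f g) (t, q) K
      ↔ K = -(η * deriv (deriv f) t / f t) ∧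
        c - η * deriv f t ^ 2 + η * f t * deriv (deriv f) t = 0 := by
  set k := chartMetric I g q with hk
  set y := extChartAt I q q with hy
  have hη0 : η ≠ 0 := by rintro rfl; norm_num at hη
  have hev : chartMetric (𝓘(ℝ, ℝ).prod I) (warpedMetric I η f g) (t, q)
      =ᶠ[𝓝 (t, y)] warpedForm η f k := by
    have : ∀ᶠ z : ℝ × E in 𝓝 (t, y), z.2 ∈ (extChartAt I q).target :=
      continuousAt_snd.eventually (extChartAt_target_mem_nhds q)
    filter_upwards [this] with z hz using chartMetric_warpedMetric hz
  have hks : ∀ a b, k y a b = k y b a := chartMetric_symm hg q y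
  have hkn : ∀ u, (∀ v, k y u v = 0) → u = 0 :=
    chartMetric_nondegenerate hg (mem_extChartAt_target q)
  have hkd := contDiffAt_chartMetric hg (mem_extChartAt_target q)
  have num : ∀ u v : ℝ × E,
      warpedForm η f k (t, y) (riemannCurvature (warpedForm η f k) (t, y) u v v) u
      = -(f t * deriv (deriv f) t * k y (u.1 • v.2 - v.1 • u.2) (u.1 • v.2 - v.1 • u.2))
        + f t ^ 2 * (c - η * deriv f t ^ 2)
          * (k y u.2 u.2 * k y v.2 v.2 - k y u.2 v.2 ^ 2) := by
    intro u v
    have h1 := apply_riemannCurvature_warpedForm (z := (t, y)) hη hf hkd hft hkn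
      (Filter.Eventually.of_forall (chartMetric_symm hg q)) u v
    have h2 := riemannCurvature_chartMetric hE hg hc u.2 v.2
    simp only at h1
    rw [h1, h2]
    ring
  have den : ∀ u v : ℝ × E, warpedForm η f k (t, y) u u * warpedForm η f k (t, y) v v
      - warpedForm η f k (t, y) u v ^ 2
      = η * f t ^ 2 * k y (u.1 • v.2 - v.1 • u.2) (u.1 • v.2 - v.1 • u.2)
        + f t ^ 4 * (k y u.2 u.2 * k y v.2 v.2 - k y u.2 v.2 ^ 2) := by
    intro u v
    simp only [warpedForm_apply, map_sub, map_smul, sub_apply, smul_apply, smul_eq_mul]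
    rw [hks v.2 u.2]
    ring
  have hself : extChartAt (𝓘(ℝ, ℝ).prod I) ((t, q) : ℝ × N) (t, q) = (t, y) :=
    extChartAt_prod_apply t q (t, q)
  refine (hasSectionalCurvatureAt_iff (I := 𝓘(ℝ, ℝ).prod I) hself hev K).trans ?_
  simp only [num, den]
  constructor
  · intro h
    obtain ⟨x, z, hx, hz, hxz⟩ := exists_nondegenerate_plane hks hkn hE
    -- A mixed plane determines `K`; a fibre plane then gives the relation.
    have h1 := h (1, 0) (0, x)
    have h2 := h (0, z) (0, x)
    rw [hks] at hxz
    simp [hxz, hη0, hft, hx, hz] at h1 h2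
    have e1 : K = -(η * deriv (deriv f) t / f t) := by
      field_simp
      have : k y x x * f t * (K * f t + η * deriv (deriv f) t) = 0 := by
        linear_combination -η * h1 - (K * f t ^ 2 * k y x x) * hη
      have := (mul_eq_zero.1 this).resolve_left (mul_ne_zero hx hft)
      linarith
    refine ⟨e1, ?_⟩
    have e2 : f t ^ 2 * k y z z * k y x x * (c - η * deriv f t ^ 2 - K * f t ^ 2) = 0 := by
      linear_combination h2
    have e3 := (mul_eq_zero.1 e2).resolve_left (mul_ne_zero (mul_ne_zero (pow_ne_zero 2 hft) hz) hx)
    rw [e1] at e3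
    field_simp at e3
    linear_combination e3
  · rintro ⟨rfl, h0⟩ u v huv
    field_simp
    linear_combination (f t * (k y u.2 u.2 * k y v.2 v.2 - k y u.2 v.2 ^ 2)) * h0
      + (deriv (deriv f) t * k y (u.1 • v.2 - v.1 • u.2) (u.1 • v.2 - v.1 • u.2)) * hη

end WarpedManifold

/-! ### The immersion in charts and its umbilic normal field -/

section SecondDerivative

theorem fderiv_fderiv_comp {V V' W : Type*} [NormedAddCommGroup V] [NormedSpace ℝ V]
    [NormedAddCommGroup V'] [NormedSpace ℝ V'] [NormedAddCommGroup W] [NormedSpace ℝ W]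
    {φ : V → W} {ψ : V' → W} {Θ : V → V'} {z : V} (hΘ : ContDiffAt ℝ ∞ Θ z)
    (hψ : ContDiffAt ℝ ∞ ψ (Θ z)) (h : φ =ᶠ[𝓝 z] fun x => ψ (Θ x)) (w u : V) :
    fderiv ℝ (fderiv ℝ φ) z w u
      = fderiv ℝ (fderiv ℝ ψ) (Θ z) (fderiv ℝ Θ z w) (fderiv ℝ Θ z u)
        + fderiv ℝ ψ (Θ z) (fderiv ℝ (fderiv ℝ Θ) z w u) := by
  have hφ : ContDiffAt ℝ ∞ φ z := (hψ.comp z hΘ).congr_of_eventuallyEq h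
  have h1 : (fun x => fderiv ℝ φ x u) =ᶠ[𝓝 z] fun x => fderiv ℝ ψ (Θ x) (fderiv ℝ Θ x u) := by
    filter_upwards [h.eventuallyEq_nhds, eventually_differentiableAt hΘ,
      hΘ.continuousAt.eventually (eventually_differentiableAt hψ)] with x hx h2 h3
    rw [hx.fderiv_eq, fderiv_fun_comp x h3 h2]
    rfl
  have d1 := ((hφ.fderiv_right (m := ∞) (by simp)).differentiableAt (by simp)).hasFDerivAt
  have d2 := ((hψ.fderiv_right (m := ∞) (by simp)).differentiableAt (by simp)).hasFDerivAt
  have d3 := ((hΘ.fderiv_right (m := ∞) (by simp)).differentiableAt (by simp)).hasFDerivAt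
  have d4 := (hΘ.differentiableAt (by simp)).hasFDerivAt
  have e1 : HasFDerivAt (fun x => fderiv ℝ φ x u) _ z := d1.clm_apply (hasFDerivAt_const u z)
  have e2 : HasFDerivAt (fun x => fderiv ℝ ψ (Θ x) (fderiv ℝ Θ x u)) _ z :=
    (d2.comp z d4).clm_apply (d3.clm_apply (hasFDerivAt_const u z))
  have := congrArg (fun L => L w) ((e1.congr_of_eventuallyEq h1.symm).unique e2)
  simp at this
  rw [this, add_comm]

end SecondDerivative

section Immersion

variable {E : Type*} [NormedAddCommGroup E] [NormedSpace ℝ E]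
  {H : Type*} [TopologicalSpace H] {I : ModelWithCorners ℝ E H} [I.Boundaryless]
  {N : Type*} [TopologicalSpace N] [ChartedSpace H N] [IsManifold I ∞ N]
  {g : ∀ x : N, TangentSpace I x →L[ℝ] TangentSpace I x →L[ℝ] ℝ} {η c : ℝ} {f : ℝ → ℝ}
  {m s : ℕ} {S : Set ℝ} {F : ℝ × N → Fin m → ℝ}

/-- The expression of a map from `ℝ × N` in the preferred chart of `N` at `q`. -/
noncomputable def chartMap {W : Type*} (I : ModelWithCorners ℝ E H) (F : ℝ × N → W) (q : N)
    (z : ℝ × E) : W :=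
  F (z.1, (extChartAt I q).symm z.2)

theorem contDiffAt_chartMap (hS : IsOpen S)
    (hF : ContMDiffOn (𝓘(ℝ, ℝ).prod I) 𝓘(ℝ, Fin m → ℝ) ∞ F (S ×ˢ univ)) {q : N} {z : ℝ × E}
    (hz : z.1 ∈ S) (hy : z.2 ∈ (extChartAt I q).target) :
    ContDiffAt ℝ ∞ (chartMap I F q) z := by
  rw [← contMDiffAt_iff_contDiffAt]
  have h1 : ContMDiffAt 𝓘(ℝ, ℝ × E) (𝓘(ℝ, ℝ).prod I) ∞
      (extChartAt (𝓘(ℝ, ℝ).prod I) ((z.1, q) : ℝ × N)).symm z :=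
    (contMDiffOn_extChartAt_symm _).contMDiffAt
      ((isOpen_extChartAt_target _).mem_nhds (mem_extChartAt_prod_target hy))
  have h2 : ContMDiffAt (𝓘(ℝ, ℝ).prod I) 𝓘(ℝ, Fin m → ℝ) ∞ F
      ((extChartAt (𝓘(ℝ, ℝ).prod I) ((z.1, q) : ℝ × N)).symm z) := by
    rw [extChartAt_prod_symm_apply]
    exact hF.contMDiffAt ((hS.prod isOpen_univ).mem_nhds ⟨hz, mem_univ _⟩)
  refine (h2.comp z h1).congr_of_eventuallyEq (Filter.Eventually.of_forall fun w => ?_)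
  simp only [Function.comp, extChartAt_prod_symm_apply]
  rfl

omit [IsManifold I ∞ N] in
theorem mfderiv_eq_fderiv_chartMap (hS : IsOpen S)
    (hF : ContMDiffOn (𝓘(ℝ, ℝ).prod I) 𝓘(ℝ, Fin m → ℝ) ∞ F (S ×ˢ univ)) {t : ℝ} (ht : t ∈ S)
    (q : N) (u : ℝ × E) :
    (mfderiv (𝓘(ℝ, ℝ).prod I) 𝓘(ℝ, Fin m → ℝ) F (t, q) u : Fin m → ℝ)
      = fderiv ℝ (chartMap I F q) (t, extChartAt I q q) u := by
  have h1 : MDifferentiableAt (𝓘(ℝ, ℝ).prod I) 𝓘(ℝ, Fin m → ℝ) F (t, q) :=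
    (hF.contMDiffAt ((hS.prod isOpen_univ).mem_nhds ⟨ht, mem_univ _⟩)).mdifferentiableAt (by simp)
  refine (congrArg (fun L : (ℝ × E) →L[ℝ] (Fin m → ℝ) => L u) h1.mfderiv).trans ?_
  simp only [ModelWithCorners.range_eq_univ, fderivWithin_univ, extChartAt_prod_apply]
  congr 2

omit [I.Boundaryless] [IsManifold I ∞ N] in
theorem chartMap_eventuallyEq {W : Type*} (F : ℝ × N → W) {q q' : N} {z : ℝ × E}
    (hy : z.2 ∈ (extChartAt I q).target) (hq : (extChartAt I q).symm z.2 = q') :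
    chartMap I F q =ᶠ[𝓝 z] fun x => chartMap I F q' (productTransition I q q' x) := by
  filter_upwards [continuousAt_snd.eventually (eventually_chart_transition hy hq)] with x hx
  simp only [chartMap, productTransition, hx]

omit [I.Boundaryless] [IsManifold I ∞ N] in
theorem productTransition_apply {q q' : N} {z : ℝ × E} (hq : (extChartAt I q).symm z.2 = q') :
    productTransition I q q' z = (z.1, extChartAt I q' q') := by
  simp only [productTransition, hq]

theorem fderiv_chartMap (hS : IsOpen S)
    (hF : ContMDiffOn (𝓘(ℝ, ℝ).prod I) 𝓘(ℝ, Fin m → ℝ) ∞ F (S ×ˢ univ)) {q q' : N} {z : ℝ × E}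
    (hz : z.1 ∈ S) (hy : z.2 ∈ (extChartAt I q).target) (hq : (extChartAt I q).symm z.2 = q')
    (u : ℝ × E) :
    fderiv ℝ (chartMap I F q) z u = fderiv ℝ (chartMap I F q') (z.1, extChartAt I q' q')
      (fderiv ℝ (productTransition I q q') z u) := by
  have h1 := contDiffAt_productTransition (I := I) hy hq
  have h2 : ContDiffAt ℝ ∞ (chartMap I F q') (productTransition I q q' z) := by
    rw [productTransition_apply hq]
    exact contDiffAt_chartMap hS hF hz (mem_extChartAt_target q')
  rw [(chartMap_eventuallyEq F hy hq).fderiv_eq,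
    fderiv_fun_comp z (h2.differentiableAt (by simp)) (h1.differentiableAt (by simp)),
    productTransition_apply hq]
  rfl

/-- Differentials on the manifold are read at chart centres; this carries the isometry condition to
all points of one chart, where it can be differentiated. -/
theorem pseudoInnerL_fderiv_chartMap (hS : IsOpen S)
    (hF : IsIsometricImmersionOver I s S (warpedMetric I η f g) F) {q : N} {z : ℝ × E}
    (hz : z.1 ∈ S) (hy : z.2 ∈ (extChartAt I q).target) (u v : ℝ × E) :
    warpedForm η f (chartMetric I g q) z u v
      = pseudoInnerL m s (fderiv ℝ (chartMap I F q) z u) (fderiv ℝ (chartMap I F q) z v) := by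
  set q' := (extChartAt I q).symm z.2 with hq
  have h1 : ∀ a b : ℝ × E, pseudoInnerL m s
      (fderiv ℝ (chartMap I F q') (z.1, extChartAt I q' q') a)
      (fderiv ℝ (chartMap I F q') (z.1, extChartAt I q' q') b)
      = warpedForm η f (chartMetric I g q') (z.1, extChartAt I q' q') a b := by
    intro a b
    rw [pseudoInnerL_apply, ← mfderiv_eq_fderiv_chartMap hS hF.smooth hz,
      ← mfderiv_eq_fderiv_chartMap hS hF.smooth hz]
    refine (hF.isometric (z.1, q') ⟨hz, mem_univ _⟩ a b).trans ?_
    rw [warpedForm_apply, chartMetric_self]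
    rfl
  rw [fderiv_chartMap hS hF.smooth hz hy rfl, fderiv_chartMap hS hF.smooth hz hy rfl, h1,
    warpedForm_apply, warpedForm_apply, chartMetric_self, fderiv_productTransition hy rfl,
    fderiv_productTransition hy rfl, chartMetric_apply g hy rfl]

variable [FiniteDimensional ℝ E]

/-- Weingarten's formula for `Z`. The derivative `dZ(X)` is orthogonal to `Z`, whose square is
constant on the slice, and its tangential part is read off from the second derivatives of `F`. Since
`Z` is given only pointwise, its differentiability is part of the claim. -/
theorem umbilic_field_hasFDerivAt (hE : 2 ≤ Module.finrank ℝ E)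
    (hm : Module.finrank ℝ E + 2 = m) (hS : IsOpen S) (hη : η ^ 2 = 1)
    (hg : IsPseudoRiemannianMetric I g)
    (hF : IsIsometricImmersionOver I s S (warpedMetric I η f g) F) {t : ℝ} (ht : t ∈ S)
    (hf : ContDiffAt ℝ ∞ f t) (hft : f t ≠ 0) {K : ℝ} (hK : K ≠ 0) {Z : N → Fin m → ℝ}
    (hZ : ∀ q w, pseudoInnerL m s (Z q)
      (fderiv ℝ (chartMap I F q) (t, extChartAt I q q) w) = 0)
    (hZZ : ∀ q, pseudoInnerL m s (Z q) (Z q) = f t ^ 2 * K)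
    (hZ2 : ∀ q X Y, fderiv ℝ (fderiv ℝ (chartMap I F q)) (t, extChartAt I q q) (0, X) (0, Y)
      = chartMetric I g q (extChartAt I q q) X Y • Z q
        + fderiv ℝ (chartMap I F q) (t, extChartAt I q q)
          (christoffel (warpedForm η f (chartMetric I g q)) (t, extChartAt I q q) (0, X) (0, Y)))
    (hT : ∀ q X, fderiv ℝ (fderiv ℝ (chartMap I F q)) (t, extChartAt I q q) (1, 0) (0, X)
      = (deriv f t / f t) • fderiv ℝ (chartMap I F q) (t, extChartAt I q q) (0, X)) (q : N) :
    HasFDerivAt (fun y => Z ((extChartAt I q).symm y))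
      (-K • (fderiv ℝ (chartMap I F q) (t, extChartAt I q q)).comp
        (ContinuousLinearMap.inr ℝ ℝ E)) (extChartAt I q q) := by
  set y₀ := extChartAt I q q with hy₀
  set k := chartMetric I g q with hk
  set φ := chartMap I F q with hφ
  set B := pseudoInnerL m s with hB
  have hy₀t : y₀ ∈ (extChartAt I q).target := mem_extChartAt_target q
  have hη0 : η ≠ 0 := by rintro rfl; norm_num at hη
  have hW : Module.finrank ℝ (ℝ × E) + 1 = Module.finrank ℝ (Fin m → ℝ) := by
    rw [Module.finrank_prod, Module.finrank_self, Module.finrank_fin_fun, ← hm]; ring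
  have hnd : ∀ (x : N) (y : E), y ∈ (extChartAt I x).target → ∀ u : ℝ × E,
      (∀ v, warpedForm η f (chartMetric I g x) (t, y) u v = 0) → u = 0 := fun x y hy =>
    warpedForm_nondegenerate hη0 hft (chartMetric_nondegenerate hg hy)
  have hD : ∀ (x : N) (y : E), y ∈ (extChartAt I x).target → ∀ u : ℝ × E,
      (∀ v, B (fderiv ℝ (chartMap I F x) (t, y) u) (fderiv ℝ (chartMap I F x) (t, y) v) = 0) →
      u = 0 := fun x y hy u hu =>
    hnd x y hy u fun v => by rw [pseudoInnerL_fderiv_chartMap hS hF ht hy]; exact hu v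
  have hZ0 : ∀ x, Z x ≠ 0 := by
    intro x hx
    have := hZZ x
    rw [hx] at this
    simp [hft, hK] at this
  obtain ⟨X₀, -, hX₀, -, -⟩ := exists_nondegenerate_plane
    (G := k y₀) (chartMetric_symm hg q _) (chartMetric_nondegenerate hg hy₀t) hE
  -- Evaluating the second fundamental form on a fixed non-null `X₀` and dividing by `k(X₀, X₀)`
  -- gives a visibly smooth formula for `Z`.
  let ψ : E → Fin m → ℝ := fun y => (k y X₀ X₀)⁻¹ •
    (fderiv ℝ (fderiv ℝ φ) (t, y) (0, X₀) (0, X₀)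
      - fderiv ℝ φ (t, y) (christoffel (warpedForm η f k) (t, y) (0, X₀) (0, X₀)))
  have hφc : ∀ y ∈ (extChartAt I q).target, ContDiffAt ℝ ∞ φ (t, y) := fun y hy =>
    contDiffAt_chartMap hS hF.smooth ht hy
  have hkc := contDiffAt_chartMetric hg hy₀t
  -- the field `Z` in the chart at `q`
  have hZψ : ∀ᶠ y in 𝓝 y₀, Z ((extChartAt I q).symm y) = ψ y := by
    have hne : ∀ᶠ y in 𝓝 y₀, k y X₀ X₀ ≠ 0 := by
      have : ContinuousAt (fun y => k y X₀ X₀) y₀ :=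
        (hkc.continuousAt.clm_apply continuousAt_const).clm_apply continuousAt_const
      exact this.eventually_ne hX₀
    filter_upwards [hne, extChartAt_target_mem_nhds (I := I) q] with y hy1 hy2
    set q' := (extChartAt I q).symm y with hq'
    set φ' := chartMap I F q' with hφ'
    set y' := extChartAt I q' q' with hy'
    have hΘc := contDiffAt_productTransition (I := I) (z := (t, y)) hy2 rfl
    have hΘy : productTransition I q q' (t, y) = (t, y') := productTransition_apply rfl
    have hφ'c : ContDiffAt ℝ ∞ φ' (productTransition I q q' (t, y)) := by
      rw [hΘy]
      exact contDiffAt_chartMap hS hF.smooth ht (mem_extChartAt_target q')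
    have hcomp := chartMap_eventuallyEq (I := I) F (z := (t, y)) hy2 rfl
    have hD1 := fun u => fderiv_chartMap (I := I) (z := (t, y)) hS hF.smooth ht hy2 rfl u
    have hsecond := fderiv_fderiv_comp hΘc hφ'c hcomp (0, X₀) (0, X₀)
    have hΘX := fderiv_productTransition (I := I) (z := (t, y)) hy2 rfl (0, X₀)
    rw [hΘX, hΘy, hZ2] at hsecond
    have hkX : chartMetric I g q' y' (fderiv ℝ (fun w => extChartAt I q'
        ((extChartAt I q).symm w)) y X₀) (fderiv ℝ (fun w => extChartAt I q'
        ((extChartAt I q).symm w)) y X₀) = k y X₀ X₀ := by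
      rw [chartMetric_self, ← chartMetric_apply g hy2 rfl]
    have hort : ∀ w, B (k y X₀ X₀ • ψ y) (fderiv ℝ φ' (t, y') w) = 0 := by
      intro w
      have hG : ∀ᶠ x in 𝓝 (t, y), ∀ a b, warpedForm η f k x a b
          = B (fderiv ℝ φ x a) (fderiv ℝ φ x b) := by
        have h1 : ∀ᶠ x : ℝ × E in 𝓝 (t, y), x.1 ∈ S :=
          continuousAt_fst.eventually (hS.mem_nhds ht)
        have h2 : ∀ᶠ x : ℝ × E in 𝓝 (t, y), x.2 ∈ (extChartAt I q).target :=
          continuousAt_snd.eventually ((isOpen_extChartAt_target q).mem_nhds hy2)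
        filter_upwards [h1, h2] with x hx1 hx2 a b
          using pseudoInnerL_fderiv_chartMap hS hF hx1 hx2 a b
      obtain ⟨X, hX⟩ := fderiv_chart_transition_surjective (I := I) hy2 rfl w.2
      have h3 := apply_fderiv_fderiv_eq (pseudoInnerL_symm s) (hφc y hy2) hG
        (isInvertible_of_nondegenerate (hnd q y hy2)) (0, X₀) (0, X₀) (w.1, X)
      rw [hD1 (w.1, X), fderiv_productTransition hy2 rfl] at h3
      simp only [ψ, smul_inv_smul₀ hy1]
      simp only at h3
      rw [hX] at h3
      exact h3
    -- Changing charts alters second derivatives by tangent vectors only, so this difference is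
    -- tangential. It is normal as well, hence zero by nondegeneracy.
    have h4 : k y X₀ X₀ • (Z q' - ψ y) = 0 := by
      obtain ⟨w, hw⟩ : ∃ w, k y X₀ X₀ • (Z q' - ψ y) = fderiv ℝ φ' (t, y') w := by
        rw [smul_sub]
        simp only [ψ, smul_inv_smul₀ hy1]
        rw [hsecond, hkX, hD1]
        refine ⟨fderiv ℝ (productTransition I q q') (t, y)
          (christoffel (warpedForm η f k) (t, y) (0, X₀) (0, X₀)) -
          christoffel (warpedForm η f (chartMetric I g q')) (t, y')
            (0, fderiv ℝ (fun w => extChartAt I q' ((extChartAt I q).symm w)) y X₀)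
            (0, fderiv ℝ (fun w => extChartAt I q' ((extChartAt I q).symm w)) y X₀) -
          fderiv ℝ (fderiv ℝ (productTransition I q q')) (t, y) (0, X₀) (0, X₀), ?_⟩
        rw [map_sub, map_sub]
        simp only
        abel
      rw [hw]
      have hw0 : w = 0 := by
        refine hD q' y' (mem_extChartAt_target q') w fun v => ?_
        rw [← hw, smul_sub, map_sub, sub_apply, hort, map_smul, smul_apply, hZ]
        simp
      rw [hw0, map_zero]
    exact sub_eq_zero.1 ((smul_eq_zero.1 h4).resolve_left hy1)
  have hψd : DifferentiableAt ℝ ψ y₀ := by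
    have hι : ContDiff ℝ ∞ (fun y : E => (t, y)) := contDiff_const.prodMk contDiff_id
    have c0 := hφc y₀ hy₀t
    have c1 : ContDiffAt ℝ ∞ (fderiv ℝ φ) (t, y₀) := c0.fderiv_right (by simp)
    have c2 : ContDiffAt ℝ ∞ (fderiv ℝ (fderiv ℝ φ)) (t, y₀) := c1.fderiv_right (by simp)
    have c3 := contDiffAt_christoffel (contDiffAt_warpedForm (η := η) (z := (t, y₀)) hf hkc)
      (isInvertible_of_nondegenerate (hnd q y₀ hy₀t)) (0, X₀) (0, X₀)
    have d1 := (c1.comp y₀ hι.contDiffAt).differentiableAt (by simp)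
    have d2 := (c2.comp y₀ hι.contDiffAt).differentiableAt (by simp)
    have d3 := (c3.comp y₀ hι.contDiffAt).differentiableAt (by simp)
    have dk := hkc.differentiableAt (by simp)
    exact (((dk.clm_apply (differentiableAt_const _)).clm_apply
      (differentiableAt_const _)).inv hX₀).smul
      (((d2.clm_apply (differentiableAt_const _)).clm_apply (differentiableAt_const _)).sub
        (d1.clm_apply d3))
  have hZd : HasFDerivAt (fun y => Z ((extChartAt I q).symm y)) (fderiv ℝ ψ y₀) y₀ :=
    hψd.hasFDerivAt.congr_of_eventuallyEq hZψ
  have hc0 := hφc y₀ hy₀t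
  have hd1 := ((hc0.fderiv_right (m := ∞) (by simp)).differentiableAt (by simp)).hasFDerivAt
  have hq₀ : (extChartAt I q).symm y₀ = q := extChartAt_to_inv q
  have hι : HasFDerivAt (fun y : E => (t, y)) (ContinuousLinearMap.inr ℝ ℝ E) y₀ :=
    hasFDerivAt_prodMk_right t y₀
  have hsym := hc0.isSymmSndFDerivAt minSmoothness_two_le_infty
  -- Differentiate `⟨Z, Dφ w⟩ = 0`; `ht2` does the same for `⟨Z, Z⟩`. As `Z` and the tangent space
  -- span everything, the two determine `dZ`.
  have ht1 : ∀ X w, B (fderiv ℝ ψ y₀ X) (fderiv ℝ φ (t, y₀) w)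
      = -B (Z q) (fderiv ℝ (fderiv ℝ φ) (t, y₀) (0, X) w) := by
    intro X w
    have e1 : HasFDerivAt (fun y => B (Z ((extChartAt I q).symm y)) (fderiv ℝ φ (t, y) w)) _ y₀ :=
      (B.hasFDerivAt.comp y₀ hZd).clm_apply
        (((hd1.comp y₀ hι).clm_apply (hasFDerivAt_const w y₀)))
    have e2 : (fun y => B (Z ((extChartAt I q).symm y)) (fderiv ℝ φ (t, y) w))
        =ᶠ[𝓝 y₀] fun _ => 0 := by
      filter_upwards [extChartAt_target_mem_nhds (I := I) q] with y hy
      rw [hφ, fderiv_chartMap (I := I) (z := (t, y)) hS hF.smooth ht hy rfl]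
      exact hZ _ _
    have := congrArg (fun L => L X) ((e1.congr_of_eventuallyEq e2.symm).unique
      (hasFDerivAt_const 0 y₀))
    simp only [add_apply, ContinuousLinearMap.comp_apply,
      ContinuousLinearMap.flip_apply, Function.comp, hq₀] at this
    simp at this
    linarith
  have ht2 : ∀ X, B (fderiv ℝ ψ y₀ X) (Z q) = 0 := by
    intro X
    have e1 : HasFDerivAt (fun y => B (Z ((extChartAt I q).symm y))
        (Z ((extChartAt I q).symm y))) _ y₀ := (B.hasFDerivAt.comp y₀ hZd).clm_apply hZd
    simp only [hZZ] at e1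
    have := congrArg (fun L => L X) (e1.unique (hasFDerivAt_const _ y₀))
    simp only [add_apply, ContinuousLinearMap.comp_apply,
      ContinuousLinearMap.flip_apply, Function.comp, hq₀] at this
    have h0 : B (Z q) (fderiv ℝ ψ y₀ X) = B (fderiv ℝ ψ y₀ X) (Z q) := pseudoInnerL_symm s _ _
    rw [h0, zero_apply] at this
    linarith
  have hfinal : fderiv ℝ ψ y₀
      = -K • (fderiv ℝ φ (t, y₀)).comp (ContinuousLinearMap.inr ℝ ℝ E) := by
    ext1 X
    rw [← sub_eq_zero]
    simp only [smul_apply, ContinuousLinearMap.comp_apply, ContinuousLinearMap.inr_apply, neg_smul,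
      sub_neg_eq_add, neg_apply]
    refine eq_zero_of_orthogonal_range (pseudoInnerL_nondegenerate s) hW (hD q y₀ hy₀t) (hZ0 q)
      (hZ q) (fun w => ?_) ?_
    · rw [map_add, add_apply, map_smul, smul_apply]
      have e1 := ht1 X w
      have e2 := pseudoInnerL_fderiv_chartMap (z := (t, y₀)) hS hF ht hy₀t (0, X) w
      have e3 : fderiv ℝ (fderiv ℝ φ) (t, y₀) (0, X) w
          = w.1 • fderiv ℝ (fderiv ℝ φ) (t, y₀) (0, X) (1, 0)
            + fderiv ℝ (fderiv ℝ φ) (t, y₀) (0, X) (0, w.2) := by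
        rw [← map_smul, ← map_add]
        simp
      rw [hsym.eq (0, X) (1, 0), hT, hZ2] at e3
      rw [e3] at e1
      rw [← e2]
      refine (congrArg (· + _) e1).trans ?_
      simp only [map_add, map_smul, hZ, hZZ, smul_eq_mul, warpedForm_apply]
      ring
    · rw [map_add, add_apply, map_smul, smul_apply]
      have e1 := hZ q (0, X)
      rw [hB, pseudoInnerL_symm] at e1
      refine (congrArg₂ (· + K • ·) (ht2 X) e1).trans ?_
      simp
  rw [hfinal] at hZd
  exact hZd

end Immersion

/-! ### Reconstruction of the rotational hypersurface -/

theorem hasFDerivAt_bilinear_zero {E W : Type*} [NormedAddCommGroup E] [NormedSpace ℝ E]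
    [NormedAddCommGroup W] [NormedSpace ℝ W] (B : W →L[ℝ] W →L[ℝ] ℝ) {a b : E → W}
    {a' b' : E →L[ℝ] W} {y : E} (ha : HasFDerivAt a a' y) (hb : HasFDerivAt b b' y)
    (h : ∀ X, B (a' X) (b y) + B (a y) (b' X) = 0) :
    HasFDerivAt (fun y => B (a y) (b y)) (0 : E →L[ℝ] ℝ) y := by
  refine ((B.hasFDerivAt.comp y ha).clm_apply hb).congr_fderiv ?_
  ext1 X
  simpa [add_comm] using h X

section Rotational

variable {E : Type*} [NormedAddCommGroup E] [NormedSpace ℝ E]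
  {H : Type*} [TopologicalSpace H] {I : ModelWithCorners ℝ E H} [I.Boundaryless]
  {N : Type*} [TopologicalSpace N] [ChartedSpace H N] [IsManifold I ∞ N]
  {g : ∀ x : N, TangentSpace I x →L[ℝ] TangentSpace I x →L[ℝ] ℝ} {η c : ℝ} {f : ℝ → ℝ}
  {m s : ℕ} {S J : Set ℝ} {F : ℝ × N → Fin m → ℝ}

theorem hasDerivAt_curve (hS : IsOpen S)
    (hF : ContMDiffOn (𝓘(ℝ, ℝ).prod I) 𝓘(ℝ, Fin m → ℝ) ∞ F (S ×ˢ univ)) {t : ℝ} (ht : t ∈ S)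
    {q : N} {y : E} (hy : y ∈ (extChartAt I q).target) :
    HasDerivAt (fun r => F (r, (extChartAt I q).symm y))
      (fderiv ℝ (chartMap I F q) (t, y) (1, 0)) t :=
  HasFDerivAt.comp_hasDerivAt (l := chartMap I F q) (f := fun r => (r, y)) t
    (((contDiffAt_chartMap (z := (t, y)) hS hF ht hy).differentiableAt (by simp)).hasFDerivAt)
    ((hasDerivAt_id t).prodMk (hasDerivAt_const t y))

theorem hasDerivAt_curve_self (hS : IsOpen S)
    (hF : ContMDiffOn (𝓘(ℝ, ℝ).prod I) 𝓘(ℝ, Fin m → ℝ) ∞ F (S ×ˢ univ)) {t : ℝ} (ht : t ∈ S)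
    (q : N) :
    HasDerivAt (fun r => F (r, q))
      (fderiv ℝ (chartMap I F q) (t, extChartAt I q q) (1, 0)) t := by
  have h := hasDerivAt_curve hS hF ht (mem_extChartAt_target (I := I) q)
  rwa [extChartAt_to_inv] at h

theorem hasFDerivAt_slice (hS : IsOpen S)
    (hF : ContMDiffOn (𝓘(ℝ, ℝ).prod I) 𝓘(ℝ, Fin m → ℝ) ∞ F (S ×ˢ univ)) {t : ℝ} (ht : t ∈ S)
    (q : N) :
    HasFDerivAt (fun y => F (t, (extChartAt I q).symm y))
      ((fderiv ℝ (chartMap I F q) (t, extChartAt I q q)).comp (ContinuousLinearMap.inr ℝ ℝ E))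
      (extChartAt I q q) :=
  (((contDiffAt_chartMap (z := (t, extChartAt I q q)) hS hF ht
    (mem_extChartAt_target q)).differentiableAt (by simp)).hasFDerivAt).comp
    (extChartAt I q q) (hasFDerivAt_prodMk_right t (extChartAt I q q))

theorem hasFDerivAt_velocity (hS : IsOpen S)
    (hF : ContMDiffOn (𝓘(ℝ, ℝ).prod I) 𝓘(ℝ, Fin m → ℝ) ∞ F (S ×ˢ univ)) {t : ℝ} (ht : t ∈ S)
    (q : N) {l : ℝ}
    (hT : ∀ X, fderiv ℝ (fderiv ℝ (chartMap I F q)) (t, extChartAt I q q) (1, 0) (0, X)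
      = l • fderiv ℝ (chartMap I F q) (t, extChartAt I q q) (0, X)) :
    HasFDerivAt (fun y => deriv (fun r => F (r, (extChartAt I q).symm y)) t)
      (l • (fderiv ℝ (chartMap I F q) (t, extChartAt I q q)).comp
        (ContinuousLinearMap.inr ℝ ℝ E)) (extChartAt I q q) := by
  have hφ := contDiffAt_chartMap (z := (t, extChartAt I q q)) hS hF ht (mem_extChartAt_target q)
  have hsym := hφ.isSymmSndFDerivAt minSmoothness_two_le_infty
  have h1 : HasFDerivAt (fun y => fderiv ℝ (chartMap I F q) (t, y) (1, 0)) _ (extChartAt I q q) :=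
    ((((hφ.fderiv_right (m := ∞) (by simp)).differentiableAt (by simp)).hasFDerivAt).comp
      (extChartAt I q q) (hasFDerivAt_prodMk_right t (extChartAt I q q))).clm_apply
      (hasFDerivAt_const (1, 0) _)
  have h2 : (fun y => deriv (fun r => F (r, (extChartAt I q).symm y)) t)
      =ᶠ[𝓝 (extChartAt I q q)] fun y => fderiv ℝ (chartMap I F q) (t, y) (1, 0) := by
    filter_upwards [extChartAt_target_mem_nhds (I := I) q] with y hy
    exact (hasDerivAt_curve hS hF ht hy).deriv
  refine (h1.congr_of_eventuallyEq h2).congr_fderiv ?_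
  ext1 X
  simp only [add_apply, ContinuousLinearMap.comp_apply,
    ContinuousLinearMap.flip_apply, smul_apply,
    ContinuousLinearMap.inr_apply, zero_apply, map_zero, zero_add]
  rw [← hT X]
  exact hsym.eq (0, X) (1, 0)

variable [FiniteDimensional ℝ E]

theorem second_derivative_chartMap (hE : 2 ≤ Module.finrank ℝ E)
    (hm : Module.finrank ℝ E + 2 = m) (hS : IsOpen S) (hη : η ^ 2 = 1)
    (hg : IsPseudoRiemannianMetric I g)
    (hF : IsIsometricImmersionOver I s S (warpedMetric I η f g) F) {t : ℝ} (ht : t ∈ S) {q : N}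
    (hc : HasSectionalCurvatureAt I g q c)
    (hf : ContDiffAt ℝ ∞ f t) (hft : f t ≠ 0)
    (hU : deriv (deriv f) t ≠ 0 ∨ c - η * deriv f t ^ 2 ≠ 0) :
    (∀ X, fderiv ℝ (fderiv ℝ (chartMap I F q)) (t, extChartAt I q q) (1, 0) (0, X)
      = (deriv f t / f t) • fderiv ℝ (chartMap I F q) (t, extChartAt I q q) (0, X)) ∧
    (deriv (deriv f) t ≠ 0 ∨ 3 ≤ Module.finrank ℝ E → c - η * deriv f t ^ 2 ≠ 0 ∧
      ∃ Z, (∀ w, pseudoInnerL m s Z (fderiv ℝ (chartMap I F q) (t, extChartAt I q q) w) = 0) ∧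
        pseudoInnerL m s Z Z = f t ^ 2 * (c - η * deriv f t ^ 2) ∧
        ∀ X Y, fderiv ℝ (fderiv ℝ (chartMap I F q)) (t, extChartAt I q q) (0, X) (0, Y)
          = chartMetric I g q (extChartAt I q q) X Y • Z
            + fderiv ℝ (chartMap I F q) (t, extChartAt I q q)
              (christoffel (warpedForm η f (chartMetric I g q)) (t, extChartAt I q q)
                (0, X) (0, Y))) := by
  have hy := mem_extChartAt_target (I := I) q
  refine warped_hypersurface_second_derivative (z := (t, extChartAt I q q))
    (pseudoInnerL_symm s) (pseudoInnerL_nondegenerate s) (by simpa using hm) hE hη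
    (contDiffAt_chartMap hS hF.smooth ht hy) ?_ hf hft (contDiffAt_chartMetric hg hy)
    (chartMetric_nondegenerate hg hy) (.of_forall fun y => chartMetric_symm hg q y)
    (riemannCurvature_chartMetric hE hg hc) hU
  have h1 : ∀ᶠ x : ℝ × E in 𝓝 (t, extChartAt I q q), x.1 ∈ S :=
    continuousAt_fst.eventually (hS.mem_nhds ht)
  have h2 : ∀ᶠ x : ℝ × E in 𝓝 (t, extChartAt I q q), x.2 ∈ (extChartAt I q).target :=
    continuousAt_snd.eventually (extChartAt_target_mem_nhds q)
  filter_upwards [h1, h2] with x hx1 hx2 a b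
    using pseudoInnerL_fderiv_chartMap hS hF hx1 hx2 a b

omit [FiniteDimensional ℝ E] in
-- By `hT`, the vector `(1/f) Dφ(0, X)` has zero derivative in `t`: the slices have parallel tangent
-- spaces along each curve.
theorem fderiv_chartMap_eq_smul (hS : IsOpen S)
    (hF : ContMDiffOn (𝓘(ℝ, ℝ).prod I) 𝓘(ℝ, Fin m → ℝ) ∞ F (S ×ˢ univ))
    (hJ : J ⊆ S) (hJo : IsOpen J) (hJc : J.OrdConnected)
    (hf : ∀ t ∈ J, DifferentiableAt ℝ f t) (hf0 : ∀ t ∈ J, f t ≠ 0) {q : N}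
    (hT : ∀ t ∈ J, ∀ X, fderiv ℝ (fderiv ℝ (chartMap I F q)) (t, extChartAt I q q) (1, 0) (0, X)
      = (deriv f t / f t) • fderiv ℝ (chartMap I F q) (t, extChartAt I q q) (0, X))
    {t t₁ : ℝ} (ht : t ∈ J) (ht₁ : t₁ ∈ J) (X : E) :
    fderiv ℝ (chartMap I F q) (t, extChartAt I q q) (0, X)
      = (f t / f t₁) • fderiv ℝ (chartMap I F q) (t₁, extChartAt I q q) (0, X) := by
  have hd : ∀ r ∈ J, HasDerivAt
      (fun r => (f r)⁻¹ • fderiv ℝ (chartMap I F q) (r, extChartAt I q q) (0, X)) 0 r := by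
    intro r hr
    have hφ := contDiffAt_chartMap (z := (r, extChartAt I q q)) hS hF (hJ hr)
      (mem_extChartAt_target q)
    have h1 : HasDerivAt (fun r => fderiv ℝ (chartMap I F q) (r, extChartAt I q q) (0, X))
        (fderiv ℝ (fderiv ℝ (chartMap I F q)) (r, extChartAt I q q) (1, 0) (0, X)) r := by
      have h2 := (((hφ.fderiv_right (m := ∞) (by simp)).differentiableAt
        (by simp)).hasFDerivAt).comp_hasDerivAt r
        ((hasDerivAt_id r).prodMk (hasDerivAt_const r (extChartAt I q q)))
      simpa using h2.clm_apply (hasDerivAt_const r ((0, X) : ℝ × E))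
    have h3 := ((hf r hr).hasDerivAt.inv (hf0 r hr)).smul h1
    refine h3.congr_deriv ?_
    rw [Pi.inv_apply, hT r hr, smul_smul, ← add_smul]
    have : (f r)⁻¹ * (deriv f r / f r) + -deriv f r / f r ^ 2 = 0 := by
      field_simp [hf0 r hr]
      ring
    rw [this, zero_smul]
  have := hJo.is_const_of_deriv_eq_zero hJc.isPreconnected
    (fun r hr => (hd r hr).differentiableAt.differentiableWithinAt)
    (fun r hr => (hd r hr).deriv) ht ht₁
  rw [div_eq_mul_inv, mul_smul, ← this, smul_inv_smul₀ (hf0 t ht)]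

/-- Umbilicity is needed at the single parameter `t₁`; at the other parameters only the principal
direction `∂_t` is used, through `fderiv_chartMap_eq_smul`. -/
theorem isRotationalOver [ConnectedSpace N] (hE : 2 ≤ Module.finrank ℝ E)
    (hm : Module.finrank ℝ E + 2 = m) (hS : IsOpen S) (hη : η ^ 2 = 1)
    (hg : IsPseudoRiemannianMetric I g) (hc : ∀ q, HasSectionalCurvatureAt I g q c)
    (hF : IsIsometricImmersionOver I s S (warpedMetric I η f g) F)
    (hJ : J ⊆ S) (hJo : IsOpen J) (hJc : J.OrdConnected)
    (hf : ∀ t ∈ J, ContDiffAt ℝ ∞ f t) (hf0 : ∀ t ∈ J, f t ≠ 0)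
    (hU : ∀ t ∈ J, deriv (deriv f) t ≠ 0 ∨ c - η * deriv f t ^ 2 ≠ 0)
    {t₁ : ℝ} (ht₁ : t₁ ∈ J) (h₁ : deriv (deriv f) t₁ ≠ 0 ∨ 3 ≤ Module.finrank ℝ E) :
    IsRotationalOver s J F := by
  have hη0 : η ≠ 0 := by rintro rfl; norm_num at hη
  have hsecond := fun (t : ℝ) (ht : t ∈ J) (q : N) => second_derivative_chartMap hE hm hS hη hg hF
    (hJ ht) (hc q) (hf t ht) (hf0 t ht) (hU t ht)
  obtain ⟨q₀⟩ : Nonempty N := inferInstance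
  have hf₁ := hf0 t₁ ht₁
  have hK := ((hsecond t₁ ht₁ q₀).2 h₁).1
  choose Z hZ hZZ hZ2 using fun q => ((hsecond t₁ ht₁ q).2 h₁).2
  set K := c - η * deriv f t₁ ^ 2 with hKdef
  set B := pseudoInnerL m s with hB
  have hBs : ∀ x y, B x y = B y x := pseudoInnerL_symm s
  let D : ℝ → N → (ℝ × E) →L[ℝ] (Fin m → ℝ) := fun t q =>
    fderiv ℝ (chartMap I F q) (t, extChartAt I q q)
  let T : N → Fin m → ℝ := fun q => deriv (fun r => F (r, q)) t₁
  have hT : ∀ q, T q = D t₁ q (1, 0) := fun q =>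
    (hasDerivAt_curve_self hS hF.smooth (hJ ht₁) q).deriv
  have hBD : ∀ t ∈ J, ∀ q u v, B (D t q u) (D t q v)
      = warpedForm η f (chartMetric I g q) (t, extChartAt I q q) u v := fun t ht q u v =>
    (pseudoInnerL_fderiv_chartMap (z := (t, extChartAt I q q)) hS hF (hJ ht)
      (mem_extChartAt_target q) u v).symm
  have hnd : ∀ t ∈ J, ∀ q u, (∀ v, B (D t q u) (D t q v) = 0) → u = 0 := fun t ht q u hu =>
    warpedForm_nondegenerate (z := (t, extChartAt I q q)) hη0 (hf0 t ht)
      (chartMetric_nondegenerate hg (mem_extChartAt_target q)) u fun v => by rw [← hBD t ht, hu]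
  have hvel : ∀ t ∈ J, ∀ q, B (D t q (1, 0)) (D t q (1, 0)) = η := fun t ht q => by
    rw [hBD t ht, warpedForm_apply]; simp
  have hvelX : ∀ t ∈ J, ∀ q X, B (D t q (1, 0)) (D t q (0, X)) = 0 := fun t ht q X => by
    rw [hBD t ht, warpedForm_apply]; simp
  have hTT : ∀ q, B (T q) (T q) = η := fun q => by rw [hT, hvel t₁ ht₁]
  have hTX : ∀ q X, B (T q) (D t₁ q (0, X)) = 0 := fun q X => by rw [hT, hvelX t₁ ht₁]
  have hTZ : ∀ q, B (T q) (Z q) = 0 := fun q => by rw [hBs, hT]; exact hZ q _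
  have hslice : ∀ t ∈ J, ∀ q X, D t q (0, X) = (f t / f t₁) • D t₁ q (0, X) := fun t ht q X =>
    fderiv_chartMap_eq_smul hS hF.smooth hJ hJo hJc
      (fun r hr => (hf r hr).differentiableAt (by simp)) hf0
      (fun r hr => (hsecond r hr q).1) ht ht₁ X
  have dT := fun q => hasFDerivAt_velocity hS hF.smooth (hJ ht₁) q (hsecond t₁ ht₁ q).1
  have dW := fun (t : ℝ) (ht : t ∈ J) (q : N) => hasFDerivAt_slice hS hF.smooth (hJ ht) q
  have dZ := fun q => umbilic_field_hasFDerivAt hE hm hS hη hg hF (hJ ht₁) (hf t₁ ht₁) hf₁ hK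
    hZ hZZ hZ2 (fun q => (hsecond t₁ ht₁ q).1) q
  -- the centre and the axis
  have ho : ∀ q, F (t₁, q) + K⁻¹ • Z q = F (t₁, q₀) + K⁻¹ • Z q₀ := fun q => by
    refine eq_of_hasFDerivAt_zero (I := I) (ζ := fun q => F (t₁, q) + K⁻¹ • Z q) (fun q => ?_) q q₀
    refine ((dW t₁ ht₁ q).add ((dZ q).const_smul K⁻¹)).congr_fderiv ?_
    rw [smul_smul, mul_neg, inv_mul_cancel₀ hK, neg_one_smul, add_neg_cancel]
  set o := F (t₁, q₀) + K⁻¹ • Z q₀ with hodef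
  -- The coefficients make the multiples `f'/f` and `-K` of `dF` cancel. One has `⟨b, b⟩ = η c f²
  -- K`, so the axis is null exactly when `c = 0`.
  have hb : ∀ q, (K * f t₁) • T q + deriv f t₁ • Z q
      = (K * f t₁) • T q₀ + deriv f t₁ • Z q₀ := fun q => by
    refine eq_of_hasFDerivAt_zero (I := I)
      (ζ := fun q => (K * f t₁) • T q + deriv f t₁ • Z q) (fun q => ?_) q q₀
    refine (((dT q).const_smul (K * f t₁)).add ((dZ q).const_smul (deriv f t₁))).congr_fderiv ?_
    rw [smul_smul, smul_smul, ← add_smul]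
    have : K * f t₁ * (deriv f t₁ / f t₁) + deriv f t₁ * -K = 0 := by
      field_simp
      ring
    rw [this, zero_smul]
  set b := (K * f t₁) • T q₀ + deriv f t₁ • Z q₀ with hbdef
  -- the position vector relative to the centre is normal to the slices
  have hpos : ∀ t ∈ J, ∀ q X, B (F (t, q) - o) (D t₁ q (0, X)) = 0 := by
    intro t ht q X
    have hd : ∀ r ∈ J, HasDerivAt (fun r => B (F (r, q) - o) (D t₁ q (0, X))) 0 r := by
      intro r hr
      have h1 := (B.flip (D t₁ q (0, X))).hasFDerivAt.comp_hasDerivAt r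
        ((hasDerivAt_curve_self hS hF.smooth (hJ hr) q).sub_const o)
      refine h1.congr_deriv ?_
      have h2 : D t₁ q (0, X) = (f r / f t₁)⁻¹ • D r q (0, X) := by
        rw [hslice r hr, inv_smul_smul₀ (div_ne_zero (hf0 r hr) hf₁)]
      rw [h2, ContinuousLinearMap.flip_apply, map_smul]
      exact (congrArg _ (hvelX r hr q X)).trans (smul_zero _)
    have h3 := hJo.is_const_of_deriv_eq_zero hJc.isPreconnected
      (fun r hr => (hd r hr).differentiableAt.differentiableWithinAt)
      (fun r hr => (hd r hr).deriv) ht ht₁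
    refine h3.trans ?_
    have h4 : F (t₁, q) - o = -(K⁻¹ • Z q) := by rw [← ho q]; abel
    simp only [h4, map_neg, map_smul, neg_apply, smul_apply]
    rw [hZ q, smul_zero, neg_zero]
  -- All derivatives along the slice are tangent to it, while `F - o`, `T` and `Z` are normal to it;
  -- hence this pairing and that in `hy` do not depend on `q`.
  have hx : ∀ t ∈ J, ∀ q, B (F (t, q) - o) (T q) = B (F (t, q₀) - o) (T q₀) := by
    intro t ht q
    refine eq_of_hasFDerivAt_zero (I := I) (ζ := fun q => B (F (t, q) - o) (T q))
      (fun q => ?_) q q₀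
    refine hasFDerivAt_bilinear_zero B ((dW t ht q).sub_const o) (dT q) fun X => ?_
    have e1 : B (F (t, q) - o) (D t₁ q (0, X)) = 0 := hpos t ht q X
    have e2 := hTX q X
    have e3 : fderiv ℝ (chartMap I F q) (t, extChartAt I q q) (0, X)
      = (f t / f t₁) • D t₁ q (0, X) := hslice t ht q X
    simp only [ContinuousLinearMap.comp_apply, ContinuousLinearMap.inr_apply, smul_apply, e3]
    rw [extChartAt_to_inv, hBs (_ • _), map_smul, map_smul]
    refine (congrArg₂ (fun a b => (f t / f t₁) • a + (deriv f t₁ / f t₁) • b) e2 e1).trans (by simp)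
  have hy : ∀ t ∈ J, ∀ q, B (F (t, q) - o) (Z q) = B (F (t, q₀) - o) (Z q₀) := by
    intro t ht q
    refine eq_of_hasFDerivAt_zero (I := I) (ζ := fun q => B (F (t, q) - o) (Z q))
      (fun q => ?_) q q₀
    refine hasFDerivAt_bilinear_zero B ((dW t ht q).sub_const o) (dZ q) fun X => ?_
    have e1 : B (F (t, q) - o) (D t₁ q (0, X)) = 0 := hpos t ht q X
    have e2 := hZ q (0, X)
    have e3 : fderiv ℝ (chartMap I F q) (t, extChartAt I q q) (0, X)
      = (f t / f t₁) • D t₁ q (0, X) := hslice t ht q X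
    simp only [ContinuousLinearMap.comp_apply, ContinuousLinearMap.inr_apply, smul_apply, e3]
    rw [extChartAt_to_inv, hBs (_ • _), map_smul, map_smul]
    refine (congrArg₂ (fun a b => (f t / f t₁) • a + (-K) • b) e2 e1).trans (by simp)
  have hZZ0 : ∀ q, B (Z q) (Z q) ≠ 0 := fun q => by
    rw [hZZ]; exact mul_ne_zero (pow_ne_zero 2 hf₁) hK
  have hZ0 : ∀ q, Z q ≠ 0 := fun q h => hZZ0 q (by rw [h]; simp)
  -- The coordinate along `T` should be divided by `⟨T, T⟩ = η`, which is its own inverse.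
  let x : ℝ → ℝ := fun t => η * B (F (t, q₀) - o) (T q₀)
  let y : ℝ → ℝ := fun t => (B (Z q₀) (Z q₀))⁻¹ * B (F (t, q₀) - o) (Z q₀)
  have hdec : ∀ t ∈ J, ∀ q, F (t, q) - o = x t • T q + y t • Z q := by
    intro t ht q
    rw [← sub_eq_zero]
    have hW : Module.finrank ℝ (ℝ × E) + 1 = Module.finrank ℝ (Fin m → ℝ) := by
      rw [Module.finrank_prod, Module.finrank_self, Module.finrank_fin_fun, ← hm]; ring
    have hν1 : B (F (t, q) - o - (x t • T q + y t • Z q)) (T q) = 0 := by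
      simp only [map_sub, map_add, map_smul, sub_apply, add_apply, smul_apply, smul_eq_mul]
      rw [hBs (Z q), hTZ, hTT, ← sub_apply, ← map_sub, hx t ht]
      simp only [x]
      linear_combination (-(B (F (t, q₀) - o) (T q₀))) * hη
    refine eq_zero_of_orthogonal_range (pseudoInnerL_nondegenerate s) hW (hnd t₁ ht₁ q) (hZ0 q)
      (hZ q) (fun u => ?_) ?_
    · have hu : D t₁ q u = u.1 • T q + D t₁ q (0, u.2) := by
        rw [hT, ← map_smul, ← map_add]; simp
      rw [hu, map_add, map_smul]
      rw [hν1, smul_zero, zero_add, map_sub, map_add, map_smul, map_smul, sub_apply, add_apply, smul_apply, smul_apply]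
      have e2 : B (Z q) (D t₁ q (0, u.2)) = 0 := hZ q _
      rw [hpos t ht, hTX, e2]
      simp
    · have e : B (F (t, q) - o - (x t • T q + y t • Z q)) (Z q) = 0 := by
        rw [map_sub, map_add, map_smul, map_smul, sub_apply, add_apply, smul_apply, smul_apply,
          hTZ, hy t ht]
        simp only [y, smul_eq_mul, hZZ q, ← hZZ q₀]
        field_simp [hZZ0 q₀]
        ring
      exact e
  have hA : ∀ q, ∃ A ∈ rotationsAbout s b, ∀ t ∈ J, F (t, q) = o + A (F (t, q₀) - o) := by
    intro q
    -- The orthogonal non-null pair `(T, Z)` is moved rather than `b`, which may be null; `b` is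
    -- then fixed, having the same coefficients in both frames.
    obtain ⟨A, hA, hA1, hA2⟩ := exists_isometry_apply_eq_pair hBs (x₁ := T q₀) (x₂ := Z q₀)
      (y₁ := T q) (y₂ := Z q) (by rwa [hTT]) (hZZ0 q₀) (hTZ q₀) (hTZ q) (by rw [hTT, hTT])
      (by rw [hZZ, hZZ])
    refine ⟨A, ⟨fun u v => ?_, ?_⟩, fun t ht => ?_⟩
    · rw [← pseudoInnerL_apply, ← pseudoInnerL_apply]; exact hA u v
    · rw [hbdef, map_add, map_smul, map_smul, hA1, hA2, hb q]
    · rw [hdec t ht q₀, map_add, map_smul, map_smul, hA1, hA2, ← hdec t ht q]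
      abel
  have hcomb : ∀ a d : ℝ, a • T q₀ + d • Z q₀ = 0 → a = 0 ∧ d = 0 := by
    intro a d h
    have e1 := congrArg (fun w => B w (T q₀)) h
    have e2 := congrArg (fun w => B w (Z q₀)) h
    simp only [map_add, map_smul, add_apply, smul_apply, smul_eq_mul, hTT, hTZ, hBs (Z q₀) (T q₀),
      map_zero, zero_apply, mul_zero, add_zero, zero_add] at e1 e2
    exact ⟨(mul_eq_zero.1 e1).resolve_right hη0, (mul_eq_zero.1 e2).resolve_right (hZZ0 q₀)⟩
  have hTP : T q₀ ∈ Submodule.span ℝ {T q₀, Z q₀} := Submodule.subset_span (by simp)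
  have hZP : Z q₀ ∈ Submodule.span ℝ {T q₀, Z q₀} := Submodule.subset_span (by simp)
  refine ⟨Submodule.span ℝ {T q₀, Z q₀}, o, b, fun t => F (t, q₀) - o, ?_, ?_, hA⟩
  · refine ⟨?_, ?_, ?_, ?_, ?_, ?_, ?_, ?_⟩
    · have hli : LinearIndependent ℝ ![T q₀, Z q₀] := LinearIndependent.pair_iff.2 hcomb
      have := finrank_span_eq_card hli
      rwa [Matrix.range_cons_cons_empty, Fintype.card_fin] at this
    · intro w hw hw'
      obtain ⟨a, d, rfl⟩ := Submodule.mem_span_pair.1 hw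
      have e1 := hw' _ hTP
      have e2 := hw' _ hZP
      rw [← pseudoInnerL_apply, ← hB] at e1 e2
      simp only [map_add, map_smul, add_apply, smul_apply, smul_eq_mul, hTT, hTZ,
        hBs (Z q₀) (T q₀), mul_zero, add_zero, zero_add] at e1 e2
      rw [(mul_eq_zero.1 e1).resolve_right hη0, (mul_eq_zero.1 e2).resolve_right (hZZ0 q₀)]
      simp
    · exact Submodule.mem_span_pair.2 ⟨_, _, rfl⟩
    · intro h
      exact mul_ne_zero hK hf₁ (hcomb _ _ h).1
    · intro t ht
      have h1 := (contDiffAt_chartMap (z := (t, extChartAt I q₀ q₀)) hS hF.smooth (hJ ht)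
        (mem_extChartAt_target q₀)).comp t
        ((contDiff_id.prodMk (contDiff_const (c := extChartAt I q₀ q₀))).contDiffAt (x := t))
      have h2 : (fun t => F (t, q₀) - o)
          = fun t => (chartMap I F q₀ ∘ fun r => (id r, extChartAt I q₀ q₀)) t - o := by
        funext r
        simp only [Function.comp, chartMap, id, extChartAt_to_inv]
      rw [h2]
      exact (h1.sub contDiffAt_const).contDiffWithinAt
    · intro t ht
      exact Submodule.mem_span_pair.2 ⟨_, _, (hdec t ht q₀).symm⟩
    · intro t ht h
      rw [((hasDerivAt_curve_self hS hF.smooth (hJ ht) q₀).sub_const o).deriv] at h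
      have := hvel t ht q₀
      simp only [D, h] at this
      simp [hη0.symm] at this
    · intro t ht h
      obtain ⟨r, hr⟩ := Submodule.mem_span_singleton.1 h
      -- A point of the profile on the axis would be fixed by every rotation, so the whole slice
      -- would collapse to it, against injectivity of the differential.
      have hconst : ∀ q, F (t, q) = o + r • b := by
        intro q
        obtain ⟨A, hA1, hA2⟩ := hA q
        rw [hA2 t ht, ← hr, map_smul, hA1.2]
      have hd := dW t ht q₀
      simp only [hconst] at hd
      have h0 := hd.unique (hasFDerivAt_const (o + r • b) _)
      have : Nontrivial E := Module.nontrivial_of_finrank_pos (R := ℝ) (by omega)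
      obtain ⟨X, hX⟩ := exists_ne (0 : E)
      have hX0 : D t q₀ (0, X) = 0 := congrArg (fun L => L X) h0
      exact hX (Prod.mk.inj (hnd t ht q₀ (0, X) fun v => by rw [hX0]; simp)).2
  · rintro _ ⟨⟨t, q⟩, ⟨ht, -⟩, rfl⟩
    obtain ⟨A, hA1, hA2⟩ := hA q
    exact ⟨t, ht, A, hA1, hA2 t ht⟩

end Rotational

/-! ### The main theorem -/

theorem theorem1 (n s : ℕ) (hn : 3 ≤ n) (hs : s ≤ n + 1)
    -- the fibre: a connected pseudo-Riemannian manifold of dimension `n - 1` and curvature `c`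
    (N : Type*) [TopologicalSpace N] [ChartedSpace (EuclideanSpace ℝ (Fin (n - 1))) N]
    [IsManifold (𝓡 (n - 1)) ∞ N] [T2Space N] [ConnectedSpace N]
    (g : ∀ x : N, TangentSpace (𝓡 (n - 1)) x →L[ℝ] TangentSpace (𝓡 (n - 1)) x →L[ℝ] ℝ)
    (hg : IsPseudoRiemannianMetric (𝓡 (n - 1)) g)
    (c : ℝ) (hc : ∀ x : N, HasSectionalCurvatureAt (𝓡 (n - 1)) g x c)
    -- the base: an open interval with the metric `η dt²`, and the warping function
    (I : Set ℝ) (hIo : IsOpen I) (hIc : I.OrdConnected)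
    (η : ℝ) (hη : η = 1 ∨ η = -1)
    (f : ℝ → ℝ) (hf : ContDiffOn ℝ ∞ f I) (hfpos : ∀ t ∈ I, 0 < f t)
    (hfnc : ¬ ∃ k : ℝ, ∀ t ∈ I, f t = k)
    -- if `n = 3`, then `f` is not affine on any open subinterval
    (hf3 : n = 3 → ∀ J ⊆ I, IsOpen J → J.Nonempty → ∃ t ∈ J, deriv (deriv f) t ≠ 0)
    (F : ℝ × N → Fin (n + 1) → ℝ)
    (hF : IsIsometricImmersionOver (𝓡 (n - 1)) s I (warpedMetric (𝓡 (n - 1)) η f g) F) :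
    ∃ U ⊆ I, IsOpen U ∧
      -- `U` is the set of those `t` for which the curvature of `M` at `(t, q)` depends on the plane
      (∀ t ∈ I, ∀ q : N, t ∈ U ↔ ¬ ∃ K : ℝ, HasSectionalCurvatureAt (𝓘(ℝ, ℝ).prod (𝓡 (n - 1)))
        (warpedMetric (𝓡 (n - 1)) η f g) (t, q) K) ∧
      (∀ J ⊆ I \ U, IsOpen J → J.OrdConnected → J.Nonempty →
        ∃ K : ℝ, ∀ t ∈ J, ∀ q : N, HasSectionalCurvatureAt (𝓘(ℝ, ℝ).prod (𝓡 (n - 1)))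
          (warpedMetric (𝓡 (n - 1)) η f g) (t, q) K) ∧
      (∀ J ⊆ U, IsOpen J → J.OrdConnected → J.Nonempty → IsRotationalOver s J F) := by
  have hη2 : η ^ 2 = 1 := by rcases hη with rfl | rfl <;> norm_num
  have hE : 2 ≤ Module.finrank ℝ (EuclideanSpace ℝ (Fin (n - 1))) := by
    rw [finrank_euclideanSpace_fin]; omega
  have hm : Module.finrank ℝ (EuclideanSpace ℝ (Fin (n - 1))) + 2 = n + 1 := by
    rw [finrank_euclideanSpace_fin]; omega
  have hfc : ∀ t ∈ I, ContDiffAt ℝ ∞ f t := fun t ht => hf.contDiffAt (hIo.mem_nhds ht)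
  have hf0 : ∀ t ∈ I, f t ≠ 0 := fun t ht => (hfpos t ht).ne'
  have hf1 : ∀ t ∈ I, ContDiffAt ℝ ∞ (deriv f) t := fun t ht => contDiffAt_infty_deriv (hfc t ht)
  have hf2 : ∀ t ∈ I, ContDiffAt ℝ ∞ (deriv (deriv f)) t := fun t ht =>
    contDiffAt_infty_deriv (hf1 t ht)
  have hsec := fun (t : ℝ) (ht : t ∈ I) (q : N) (K : ℝ) =>
    sectionalCurvature_warpedMetric hE hg hη2 (hc q) (hfc t ht) (hf0 t ht) K
  -- `δ` is `f²` times the difference between the fibre and mixed sectional curvatures; it does not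
  -- involve `q`.
  set δ : ℝ → ℝ := fun t => c - η * deriv f t ^ 2 + η * f t * deriv (deriv f) t with hδ
  have hδc : ContinuousOn δ I := fun t ht =>
    ((continuousAt_const.sub (continuousAt_const.mul ((hf1 t ht).continuousAt.pow 2))).add
      ((continuousAt_const.mul (hfc t ht).continuousAt).mul
        (hf2 t ht).continuousAt)).continuousWithinAt
  refine ⟨I ∩ δ ⁻¹' {0}ᶜ, inter_subset_left, hδc.isOpen_inter_preimage hIo isOpen_compl_singleton,
    fun t ht q => ?_, fun J hJ hJo hJc ⟨t₀, ht₀⟩ => ?_, fun J hJ hJo hJc hJn => ?_⟩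
  · simp only [hsec t ht q, exists_eq_left]
    exact ⟨fun h h' => h.2 h', fun h => ⟨ht, h⟩⟩
  · have hJI : J ⊆ I := fun t ht => (hJ ht).1
    have hJ0 : ∀ t ∈ J, δ t = 0 := fun t ht => by
      by_contra h
      exact (hJ ht).2 ⟨hJI ht, h⟩
    -- Its derivative is `-2 f' δ / f³`.
    have hd : ∀ t ∈ J, HasDerivAt (fun t => (c - η * deriv f t ^ 2) / f t ^ 2) 0 t := by
      intro t ht
      have d0 := ((hfc t (hJI ht)).differentiableAt (by simp)).hasDerivAt
      have d1 := ((hf1 t (hJI ht)).differentiableAt (by simp)).hasDerivAt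
      have h0 := hf0 t (hJI ht)
      refine ((((d1.pow 2).const_mul η).const_sub c).div (d0.pow 2)
        (pow_ne_zero 2 h0)).congr_deriv ?_
      have h1 := hJ0 t ht
      simp only [hδ] at h1
      rw [div_eq_zero_iff]
      left
      simp only [Pi.pow_apply]
      push_cast
      linear_combination (-2 * f t * deriv f t) * h1
    refine ⟨(c - η * deriv f t₀ ^ 2) / f t₀ ^ 2, fun t ht q => (hsec t (hJI ht) q _).2
      ⟨?_, hJ0 t ht⟩⟩
    rw [hJo.is_const_of_deriv_eq_zero hJc.isPreconnected
      (fun r hr => (hd r hr).differentiableAt.differentiableWithinAt)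
      (fun r hr => (hd r hr).deriv) ht₀ ht]
    have h0 := hf0 t (hJI ht)
    have h1 := hJ0 t ht
    simp only [hδ] at h1
    field_simp
    linear_combination h1
  · have hJI : J ⊆ I := fun t ht => (hJ ht).1
    obtain ⟨t₁, ht₁, h₁⟩ : ∃ t₁ ∈ J, deriv (deriv f) t₁ ≠ 0 ∨
        3 ≤ Module.finrank ℝ (EuclideanSpace ℝ (Fin (n - 1))) := by
      rcases hn.eq_or_lt with h | h
      · obtain ⟨t, ht, ht'⟩ := hf3 h.symm J hJI hJo hJn
        exact ⟨t, ht, .inl ht'⟩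
      · obtain ⟨t, ht⟩ := hJn
        exact ⟨t, ht, .inr (by rw [finrank_euclideanSpace_fin]; omega)⟩
    refine isRotationalOver hE hm hIo hη2 hg hc hF hJI hJo hJc (fun t ht => hfc t (hJI ht))
      (fun t ht => hf0 t (hJI ht)) (fun t ht => ?_) ht₁ h₁
    -- If `f''` and `c - η f'²` both vanished, so would `δ`.
    by_contra! h
    refine (hJ ht).2 ?_
    show δ t = 0
    simp only [hδ, h.1, h.2]
    ring
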